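/- Let $\theta>0$, $0<q\le 1$, $\kappa>2(1+2q)$, and let $\alpha=\alpha(\theta)\in(0,1)$ be fixed such that $(1+\theta)(1-\alpha)>1$. Then there are constants $C>0$ and $c>0$ depending only on $\theta,\kappa,q$ (and on the choice of $\alpha=\alpha(\theta)$) such that the following holds. Let $n,d\ge 1$ and observe $y_i=f_i+\varepsilon_i\in\mathbb R^{d}$, $1\le i\le n$, where the $f_i$ are deterministic and the $\varepsilon_i$ are i.i.d. random vectors with $\mathbb E\,\varepsilon_1=0$, $\mathbb E\|\varepsilon_1\|^{\kappa}<\infty$ and covariance matrix $\Phi$. Write $f,y,\varepsilon\in\mathbb R^{nd}$ for the stacked vectors and $\|v\|_n^2=\frac1n\sum_{i=1}^n v_i^\top v_i$ for $v=(v_1^\top,\dots,v_n^\top)^\top\in\mathbb R^{nd}$. Let $(\mathcal S_m)_{m\in\mathcal M}$ be a finite non-empty family of linear subspaces of $\mathbb R^{nd}$ with dimensions $D_m>0$, let $P_m$ be the orthogonal projection onto $\mathcal S_m$, and put $$\delta_m^2=\frac{\mathrm{Tr}\big(P_m(I_n\otimes\Phi)\big)}{D_m},\qquad \delta_{\sup}^2=\max_{m\in\mathcal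 M}\delta_m^2,$$ where $\delta_m>0$ for all $m$. Let $\widehat\delta_m^2\ge 0$ be random variables (estimators of $\delta_m^2$) such that * (A1) $\mathbb E\,\widehat\delta_m^2\le\delta_m^2$ for all $m\in\mathcal M$; * (A2) $\mathbb P\big(\exists m\in\mathcal M:\ \widehat\delta_m^2<(1-\alpha)\delta_m^2\big)\le \tilde C(\alpha)\,n^{-\gamma}$ for some real $\tilde C(\alpha)$ and some $\gamma\ge \frac{q}{1-2q/\kappa}$. Let $\widetilde m\in\mathcal M$ be a (measurable) minimizer of $m\mapsto\|y-P_my\|_n^2+(1+\theta)\frac{\widehat\delta_m^2D_m}{n}$ and $\widetilde f=P_{\widetilde m}y$. Then $\mathbb E\|f-\widetilde f\|_n^{2q}<\infty$ and $$\Big(\mathbb E\|f-\widetilde f\|_n^{2q}\Big)^{1/q}\le C\inf_{m\in\mathcal M}\Big(\|f-P_mf\|_n^2+\frac{\delta_m^2D_m}{n}\Big)+\frac Cn\Big[\widetilde\Delta_\kappa\Big(\big(\mathbb E\|\varepsilon_1\|^\kappa\big)^{2/\kappa}+\|f\|_n^2\Big)+\delta_{\sup}^2\,\Delta_\kappa\Big],$$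 where $$\widetilde\Delta_\kappa^{\,q}=\tilde C(\alpha)^{\,1-2q/\kappa},\qquad \Delta_\kappa^{\,q}=c\;\mathbb E\|\varepsilon_1\|^\kappa\sum_{m\in\mathcal M}\delta_m^{-\kappa}D_m^{-(\kappa/2-1-q)}.$$ -/

import Mathlib

open MeasureTheory ProbabilityTheory
open scoped Kronecker

noncomputable section

namespace VecReg

/-- The space `ℝ^{nd}` of stacked vectors `(v₁ᵀ, …, vₙᵀ)ᵀ` with blocks `vᵢ ∈ ℝ^d`;
the coordinate `(i, a)` is the `a`-th coordinate of the `i`-th block. -/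
abbrev Stacked (n d : ℕ) : Type := EuclideanSpace ℝ (Fin n × Fin d)

/-- Stacking `n` vectors of `ℝ^d` into one vector of `ℝ^{nd}`. -/
def stack {n d : ℕ} (v : Fin n → EuclideanSpace ℝ (Fin d)) : Stacked n d :=
  WithLp.toLp 2 fun ia => v ia.1 ia.2

/-- The empirical norm, `‖v‖ₙ² = (1/n) ∑ᵢ vᵢᵀ vᵢ`. -/
def empNorm {n d : ℕ} (v : Stacked n d) : ℝ :=
  Real.sqrt ((1 / (n : ℝ)) * ∑ i : Fin n, ∑ a : Fin d, v (i, a) * v (i, a))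

/-- The orthogonal projection onto a model `S`. -/
def proj {n d : ℕ} (S : Submodule ℝ (Stacked n d)) : Stacked n d →L[ℝ] Stacked n d :=
  S.starProjection

/-- The matrix of the orthogonal projection onto `S` in the canonical basis of `ℝ^{nd}`. -/
def projMatrix {n d : ℕ} (S : Submodule ℝ (Stacked n d)) :
    Matrix (Fin n × Fin d) (Fin n × Fin d) ℝ :=
  LinearMap.toMatrix (EuclideanSpace.basisFun (Fin n × Fin d) ℝ).toBasis
    (EuclideanSpace.basisFun (Fin n × Fin d) ℝ).toBasis
    (proj S : Stacked n d →ₗ[ℝ] Stacked n d)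

/-- The dimension `D` of a model. -/
def modelDim {n d : ℕ} (S : Submodule ℝ (Stacked n d)) : ℕ := Module.finrank ℝ S

/-- The covariance matrix `V(X)` of a random vector. -/
def covMatrix {Ω : Type*} [MeasurableSpace Ω] (μ : Measure Ω) {d : ℕ}
    (X : Ω → EuclideanSpace ℝ (Fin d)) : Matrix (Fin d) (Fin d) ℝ :=
  Matrix.of fun a b => covariance (fun ω => X ω a) (fun ω => X ω b) μ

/-- `δ² = Tr(P (Iₙ ⊗ Φ)) / D` for the model `S`. -/
def deltaSq {n d : ℕ} (Φ : Matrix (Fin d) (Fin d) ℝ) (S : Submodule ℝ (Stacked n d)) : ℝ :=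
  (projMatrix S * ((1 : Matrix (Fin n) (Fin n) ℝ) ⊗ₖ Φ)).trace / (modelDim S : ℝ)

/-- `δ`, the nonnegative square root of `δ²`. -/
def delta {n d : ℕ} (Φ : Matrix (Fin d) (Fin d) ℝ) (S : Submodule ℝ (Stacked n d)) : ℝ :=
  Real.sqrt (deltaSq Φ S)

/-- `δ_sup² = max {δ_m² : m ∈ M}`. -/
def deltaSupSq {n d : ℕ} {M : Type*} [Fintype M] [Nonempty M]
    (Φ : Matrix (Fin d) (Fin d) ℝ) (S : M → Submodule ℝ (Stacked n d)) : ℝ :=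
  Finset.univ.sup' Finset.univ_nonempty fun m => deltaSq Φ (S m)

/-- The penalty `(1 + θ) s D / n` of a model `S`, where `s` stands for (an estimate of) `δ²`. -/
def penalty {n d : ℕ} (θ s : ℝ) (S : Submodule ℝ (Stacked n d)) : ℝ :=
  (1 + θ) * (s * (modelDim S : ℝ) / (n : ℝ))

/-- The penalized least-squares criterion `‖y - P y‖ₙ² + pen`. -/
def criterion {n d : ℕ} (θ s : ℝ) (S : Submodule ℝ (Stacked n d)) (y : Stacked n d) : ℝ :=
  empNorm (y - proj S y) ^ 2 + penalty θ s S

/-- `Δ_κ`, given by `Δ_κ^q = c E ∑_m δ_m^{-κ} D_m^{-(κ/2-1-q)}`, where `E` is the moment of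
order `κ` of the norm of the errors and `c` a constant. -/
def DeltaKappa {n d : ℕ} {M : Type*} [Fintype M] (c q κ E : ℝ)
    (Φ : Matrix (Fin d) (Fin d) ℝ) (S : M → Submodule ℝ (Stacked n d)) : ℝ :=
  (c * E * ∑ m, delta Φ (S m) ^ (-κ) * (modelDim (S m) : ℝ) ^ (-(κ / 2 - 1 - q))) ^ (1 / q)

/-- `Δ̃_κ`, given by `Δ̃_κ^q = C̃^{1 - 2q/κ}`. -/
def DeltaTilde (q κ Ctilde : ℝ) : ℝ := (Ctilde ^ (1 - 2 * q / κ)) ^ (1 / q)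

end VecReg

end

/-!
Write `F` and `e` for the stacked means and errors, `P` for the projection on a model, `D` for its
dimension, `V = δ² D` for the mean of `‖P e‖²`, and `E` for the moment of order `κ` of the norm of
one error. Comparing the criterion of the selected model with that of a competitor bounds the loss
`‖F - P (F + e)‖²` of the selected model by the oracle terms of the competitor plus `‖P e‖²` plus a
cross term `⟪F - P F, e⟫`, minus the penalty. When no `δ²` is underestimated by more than the
factor `1 - α`, the penalty is at least `(1 + b) V` with `b = (1 + θ) (1 - α) - 1 > 0`. Part of the
surplus `b V` absorbs the cross term and the rest leaves room for a fluctuation of `‖P e‖²`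
(`VecReg.loss_le_of_penalty`). The index of the selected model is random, so the excesses are
summed over all models. On the exceptional event the loss is at most `‖F‖² + ‖e‖²`, and Hölder's
inequality produces the term with `DeltaTilde` (`VecReg.integral_indicator_loss_le`).

What remains is to bound, for a fixed model, the expectation of the `q`-th power of the excess of
`‖P e‖²` over `(1 + b / 2) V` by a constant times `D E V ^ (q - κ / 2)`
(`exists_integral_sq_norm_sub_le`, for general sums of independent vectors of a Hilbert space). The
exponents leave no room: a Rosenthal inequality for the norm of `P e` would lose a constant factor
in front of `V`, and one for `‖P e‖² - V` with the crude variance would lose powers of `D`. Instead,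
`‖∑ Xᵢ‖²` is split into its off-diagonal part and its diagonal `∑ ‖Xᵢ‖²`.

* The off-diagonal part has moments of order `κ`, of size `A V ^ (κ / 2) + A ^ 2` with `A = D E`
  (`exists_integral_offDiag_le`). Adding one index `i` to the sum adds `2 ⟪S, Xᵢ⟫`, with `S` the
  partial sum, independent of `Xᵢ`; for a frozen value of `Xᵢ` only the weak moments of `S` are
  involved, and these are governed by `A` and not by `V`.
* The diagonal has only moments of order `κ / 2`; it is truncated at the level `V`, and the truncated
  sum has moments of order `2 κ` (`exists_integral_truncAt_sum_le`).

If `A ≥ V ^ (κ / 2)`, the claim follows from the strong moment of the sum alone; otherwise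
`A ^ 2 ≤ A V ^ (κ / 2)`, and both parts are linear in `A`. All moment inequalities come from the
uniform smoothness of `‖·‖ ^ p` (`exists_norm_add_rpow_le`) through a discrete comparison principle
(`rpow_le_of_insert_le`), which in particular yields Rosenthal's inequality (`exists_rosenthal`).
-/

/-! ### Elementary inequalities -/

/-- Second-order Taylor bound for `z ↦ (1 + z) ^ r` on `[-1, 1]`. -/
lemma exists_one_add_rpow_le {r : ℝ} (hr : 1 ≤ r) :
    ∃ C : ℝ, 0 ≤ C ∧ ∀ z : ℝ, |z| ≤ 1 → (1 + z) ^ r ≤ 1 + r * z + C * z ^ 2 := by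
  obtain ⟨k, hk⟩ := exists_nat_ge (r - 1)
  refine ⟨r * (2 ^ k + k), by positivity, fun z hz => ?_⟩
  obtain ⟨hz1, hz2⟩ := abs_le.1 hz
  rcases hz1.eq_or_lt with h | h
  · rw [← h, add_neg_cancel, Real.zero_rpow (by linarith)]
    have : (1 : ℝ) ≤ 2 ^ k := one_le_pow₀ (by norm_num)
    nlinarith [mul_nonneg (by linarith : 0 ≤ r) (Nat.cast_nonneg k : (0 : ℝ) ≤ k)]
  have hw : 0 < 1 + z := by linarith
  -- the tangent of the convex function at `z`, evaluated at `0`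
  have h1 : (1 + z) ^ r ≤ 1 + r * ((1 + z) ^ (r - 1) * z) := by
    have hb := one_add_mul_self_le_rpow_one_add (s := (1 + z)⁻¹ - 1)
      (by linarith [inv_pos.2 hw]) hr
    rw [add_sub_cancel, Real.inv_rpow hw.le] at hb
    have hp : 0 < (1 + z) ^ r := Real.rpow_pos_of_pos hw r
    have := mul_le_mul_of_nonneg_right hb hp.le
    rw [inv_mul_cancel₀ hp.ne'] at this
    rw [Real.rpow_sub_one hw.ne']
    have e : (1 + r * ((1 + z)⁻¹ - 1)) * (1 + z) ^ r
        = (1 + z) ^ r - r * ((1 + z) ^ r / (1 + z) * z) := by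
      field_simp; ring
    linarith
  have h2 : (1 + z) ^ (r - 1) * z ≤ z + (2 ^ k + k) * z ^ 2 := by
    rcases le_total 0 z with h0 | h0
    · have h3 : (1 + z) ^ (r - 1) ≤ (1 + z) ^ (k : ℝ) :=
        Real.rpow_le_rpow_of_exponent_le (by linarith) hk
      rw [Real.rpow_natCast] at h3
      have h4 : (1 + z) ^ k ≤ 1 + 2 ^ k * z := by
        have := (convexOn_pow (𝕜 := ℝ) k).2 (Set.mem_Ici.2 zero_le_one)
          (Set.mem_Ici.2 zero_le_two) (by linarith : 0 ≤ 1 - z) h0 (by ring)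
        simp only [smul_eq_mul, one_pow, mul_one] at this
        calc (1 + z) ^ k = (1 - z + z * 2) ^ k := by ring
          _ ≤ 1 - z + z * 2 ^ k := this
          _ ≤ _ := by linarith
      have : (1 + z) ^ (r - 1) * z ≤ (1 + 2 ^ k * z) * z :=
        mul_le_mul_of_nonneg_right (h3.trans h4) h0
      nlinarith [mul_nonneg (Nat.cast_nonneg k : (0 : ℝ) ≤ k) (sq_nonneg z)]
    · have h3 : (1 + z) ^ (k : ℝ) ≤ (1 + z) ^ (r - 1) :=
        Real.rpow_le_rpow_of_exponent_ge hw (by linarith) hk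
      rw [Real.rpow_natCast] at h3
      have h4 := one_add_mul_le_pow (by linarith : -2 ≤ z) k
      have : (1 + z) ^ (r - 1) * z ≤ (1 + k * z) * z :=
        mul_le_mul_of_nonpos_right (h4.trans h3) h0
      nlinarith [mul_nonneg (by positivity : (0 : ℝ) ≤ 2 ^ k) (sq_nonneg z)]
  nlinarith [mul_le_mul_of_nonneg_left h2 (by linarith : 0 ≤ r)]

/-- Uniform smoothness of `‖·‖ ^ p` in a real inner product space. -/
lemma exists_norm_add_rpow_le {p : ℝ} (hp : 2 ≤ p) :
    ∃ C : ℝ, 0 ≤ C ∧ ∀ {H : Type*} [NormedAddCommGroup H] [InnerProductSpace ℝ H] (s x : H),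
      ‖s + x‖ ^ p ≤ ‖s‖ ^ p + p * (‖s‖ ^ (p - 2) * inner ℝ s x)
        + C * (‖s‖ ^ (p - 2) * ‖x‖ ^ 2 + ‖x‖ ^ p) := by
  obtain ⟨C, hC, hT⟩ := exists_one_add_rpow_le (r := p / 2) (by linarith)
  refine ⟨p + 9 * C + (4 ^ p + p * 3 ^ (p - 1)), by positivity, fun {H} _ _ s x => ?_⟩
  have hin := abs_le.1 (abs_real_inner_le_norm s x)
  have hs0 := norm_nonneg s
  have hx0 := norm_nonneg x
  have hA : 0 ≤ ‖s‖ ^ (p - 2) * ‖x‖ ^ 2 := by positivity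
  have hB : 0 ≤ ‖x‖ ^ p := by positivity
  have hK : 0 ≤ 4 ^ p + p * 3 ^ (p - 1) := by positivity
  rcases le_or_gt ‖x‖ (‖s‖ / 3) with h | h
  · rcases hs0.eq_or_lt with h0 | h0
    · have : s = 0 := norm_eq_zero.1 h0.symm
      have hx : x = 0 := norm_eq_zero.1 (le_antisymm (by linarith) hx0)
      subst this; subst hx
      simp [Real.zero_rpow (by linarith : p ≠ 0)]
    -- the small perturbation regime: Taylor expansion of `(‖s‖² + b) ^ (p / 2)`
    set b : ℝ := 2 * inner ℝ s x + ‖x‖ ^ 2 with hb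
    have hbs : |b| ≤ 3 * (‖s‖ * ‖x‖) := by
      rw [abs_le]; constructor <;> nlinarith
    have hz : |b / ‖s‖ ^ 2| ≤ 1 := by
      rw [abs_div, abs_of_pos (by positivity : 0 < ‖s‖ ^ 2), div_le_one (by positivity)]
      nlinarith
    have h1 := hT _ hz
    have h2 : ‖s + x‖ ^ p = ‖s‖ ^ p * (1 + b / ‖s‖ ^ 2) ^ (p / 2) := by
      have e1 : ‖s + x‖ ^ 2 = ‖s‖ ^ 2 * (1 + b / ‖s‖ ^ 2) := by
        rw [norm_add_sq_real]; field_simp; rw [hb]; ring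
      have e2 : ∀ y : ℝ, 0 ≤ y → y ^ p = (y ^ 2) ^ (p / 2) := fun y hy => by
        rw [← Real.rpow_natCast, ← Real.rpow_mul hy]; congr 1; push_cast; ring
      rw [e2 _ (norm_nonneg _), e1, Real.mul_rpow (by positivity) (by linarith [(abs_le.1 hz).1]),
        ← e2 _ hs0]
    have e3 : ‖s‖ ^ p = ‖s‖ ^ (p - 2) * ‖s‖ ^ 2 := by
      rw [← Real.rpow_natCast, ← Real.rpow_add h0]; congr 1; push_cast; ring
    have hs2 : 0 ≤ ‖s‖ ^ (p - 2) := by positivity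
    have h3 : ‖s + x‖ ^ p ≤ ‖s‖ ^ p + p / 2 * (‖s‖ ^ (p - 2) * b)
        + C * (‖s‖ ^ (p - 2) * (b ^ 2 / ‖s‖ ^ 2)) := by
      rw [h2]
      refine (mul_le_mul_of_nonneg_left h1 (by positivity)).trans (le_of_eq ?_)
      rw [e3]; field_simp
    have h4 : b ^ 2 / ‖s‖ ^ 2 ≤ 9 * ‖x‖ ^ 2 := by
      rw [div_le_iff₀ (by positivity)]
      have := sq_le_sq' (abs_le.1 hbs).1 (abs_le.1 hbs).2
      nlinarith
    have h5 := mul_le_mul_of_nonneg_left (mul_le_mul_of_nonneg_left h4 hs2) hC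
    have h6 : p / 2 * (‖s‖ ^ (p - 2) * b)
        = p * (‖s‖ ^ (p - 2) * inner ℝ s x) + p / 2 * (‖s‖ ^ (p - 2) * ‖x‖ ^ 2) := by
      rw [hb]; ring
    nlinarith [mul_nonneg (by linarith : 0 ≤ p) hA, mul_nonneg (by linarith : 0 ≤ p) hB,
      mul_nonneg hC hB, mul_nonneg hK hA, mul_nonneg hK hB]
  · -- the large perturbation regime: every term is at most a multiple of `‖x‖ ^ p`
    have hxp : 0 < ‖x‖ := by linarith [div_nonneg hs0 (by norm_num : (0 : ℝ) ≤ 3)]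
    have h1 : ‖s + x‖ ^ p ≤ 4 ^ p * ‖x‖ ^ p := by
      rw [← Real.mul_rpow (by norm_num) hx0]
      exact Real.rpow_le_rpow (norm_nonneg _) (by linarith [norm_add_le s x]) (by linarith)
    have h2 : -(‖s‖ ^ (p - 2) * inner ℝ s x) ≤ 3 ^ (p - 1) * ‖x‖ ^ p := by
      have h3 : ‖s‖ ^ (p - 2) ≤ (3 * ‖x‖) ^ (p - 2) :=
        Real.rpow_le_rpow hs0 (by linarith) (by linarith)
      calc -(‖s‖ ^ (p - 2) * inner ℝ s x) = ‖s‖ ^ (p - 2) * -inner ℝ s x := by ring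
        _ ≤ ‖s‖ ^ (p - 2) * (‖s‖ * ‖x‖) :=
          mul_le_mul_of_nonneg_left (by linarith) (by positivity)
        _ ≤ (3 * ‖x‖) ^ (p - 2) * ((3 * ‖x‖) * ‖x‖) := by
          gcongr; linarith
        _ = 3 ^ (p - 1) * ‖x‖ ^ p := by
          rw [Real.mul_rpow (by norm_num) hx0]
          have e1 : (3 : ℝ) ^ (p - 1) = 3 ^ (p - 2) * 3 := by
            rw [← Real.rpow_add_one (by norm_num)]; congr 1; ring
          have e2 : ‖x‖ ^ p = ‖x‖ ^ (p - 2) * ‖x‖ ^ 2 := by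
            rw [← Real.rpow_natCast, ← Real.rpow_add hxp]; congr 1; push_cast; ring
          rw [e1, e2]; ring
    have h0 : 0 ≤ ‖s‖ ^ p := by positivity
    nlinarith [mul_nonneg (by linarith : 0 ≤ p) hA, mul_nonneg (by linarith : 0 ≤ p) hB,
      mul_nonneg hC hB, mul_nonneg hC hA, mul_nonneg hK hA,
      mul_le_mul_of_nonneg_left h2 (by linarith : 0 ≤ p)]

/-- A discrete Gronwall-type comparison: moments that grow by at most
`C * (φ ^ (1 - 2 / p) * v + a)` at each step are controlled by `(∑ v) ^ (p / 2) + ∑ a`.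
It turns the one-step smoothness bound into moment inequalities of Rosenthal type. -/
lemma rpow_le_of_insert_le {p C : ℝ} (hp : 2 < p) (hC : 0 ≤ C) {ι : Type*} [DecidableEq ι]
    (φ : Finset ι → ℝ) (v a : ι → ℝ) (hφ : ∀ u, 0 ≤ φ u) (h0 : φ ∅ = 0) (hv : ∀ i, 0 ≤ v i)
    (ha : ∀ i, 0 ≤ a i)
    (hstep : ∀ u i, i ∉ u → φ (insert i u) ≤ φ u + C * (φ u ^ (1 - 2 / p) * v i + a i))
    (s : Finset ι) :
    φ s ≤ ((2 * C) ^ (p / 2) + 2 * C) * ((∑ i ∈ s, v i) ^ (p / 2) + ∑ i ∈ s, a i) := by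
  obtain ⟨w, hw, hmax⟩ := s.powerset.exists_max_image φ ⟨∅, by simp⟩
  have hp2 : 0 ≤ 1 - 2 / p := by
    rw [sub_nonneg, div_le_one (by linarith)]; exact hp.le
  set T := φ w with hT
  have hT0 : 0 ≤ T := hφ w
  have hind : ∀ u ⊆ s, φ u ≤ C * (T ^ (1 - 2 / p) * ∑ i ∈ u, v i + ∑ i ∈ u, a i) := by
    intro u
    induction u using Finset.induction_on with
    | empty => intro _; simp [h0]
    | insert i u hi ih =>
      intro hu
      have hus : u ⊆ s := (Finset.subset_insert i u).trans hu
      rw [Finset.sum_insert hi, Finset.sum_insert hi]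
      have h1 : φ u ^ (1 - 2 / p) ≤ T ^ (1 - 2 / p) :=
        Real.rpow_le_rpow (hφ u) (hmax u (Finset.mem_powerset.2 hus)) hp2
      have h2 := mul_le_mul_of_nonneg_left
        (add_le_add_left (mul_le_mul_of_nonneg_right h1 (hv i)) (a i)) hC
      linarith [hstep u i hi, ih hus]
  have hV : 0 ≤ ∑ i ∈ s, v i := Finset.sum_nonneg fun i _ => hv i
  have ha' : 0 ≤ ∑ i ∈ s, a i := Finset.sum_nonneg fun i _ => ha i
  have hws := Finset.mem_powerset.1 hw
  have hTle : T ≤ C * (T ^ (1 - 2 / p) * ∑ i ∈ s, v i + ∑ i ∈ s, a i) := by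
    refine (hind w hws).trans (mul_le_mul_of_nonneg_left (add_le_add
      (mul_le_mul_of_nonneg_left ?_ (by positivity)) ?_) hC)
    · exact Finset.sum_le_sum_of_subset_of_nonneg hws fun i _ _ => hv i
    · exact Finset.sum_le_sum_of_subset_of_nonneg hws fun i _ _ => ha i
  refine (hmax s (Finset.mem_powerset.2 (Finset.Subset.refl s))).trans ?_
  set V := ∑ i ∈ s, v i
  set a' := ∑ i ∈ s, a i
  have hq1 : 0 ≤ (2 * C) ^ (p / 2) := by positivity
  have hq2 : 0 ≤ V ^ (p / 2) := by positivity
  rcases le_total (T ^ (1 - 2 / p) * V) a' with h | h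
  · nlinarith [mul_le_mul_of_nonneg_left h hC, mul_nonneg hq1 hq2, mul_nonneg hq1 ha',
      mul_nonneg hC hq2]
  · rcases hT0.eq_or_lt with hz | hz
    · rw [← hz]; positivity
    have h1 : T ≤ 2 * C * V * T ^ (1 - 2 / p) := by
      nlinarith [mul_le_mul_of_nonneg_left h hC]
    have h2 : T ^ (2 / p) ≤ 2 * C * V := by
      have e : T = T ^ (2 / p) * T ^ (1 - 2 / p) := by
        rw [← Real.rpow_add hz]; simp
      exact le_of_mul_le_mul_right (e.symm.trans_le h1) (Real.rpow_pos_of_pos hz _)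
    have h3 : T ≤ (2 * C) ^ (p / 2) * V ^ (p / 2) := by
      rw [← Real.mul_rpow (by positivity) hV]
      calc T = (T ^ (2 / p)) ^ (p / 2) := by
            rw [← Real.rpow_mul hT0, div_mul_div_cancel₀ (by linarith), div_self two_ne_zero,
              Real.rpow_one]
        _ ≤ _ := Real.rpow_le_rpow (by positivity) h2 (by linarith)
    nlinarith [mul_nonneg hq1 ha', mul_nonneg hC hq2, mul_nonneg hC ha']

/-- The `q`-th power of the excess of `y` over a level `c` is at most a power of `y` of any higher
order `m`. Applied pointwise, this replaces the integration of tail probabilities. -/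
lemma max_sub_rpow_le {y c q m : ℝ} (hy : 0 ≤ y) (hc : 0 < c) (hq : 0 < q) (hm : q ≤ m) :
    (max (y - c) 0) ^ q ≤ y ^ m * c ^ (q - m) := by
  rcases le_or_gt y c with h | h
  · rw [max_eq_right (by linarith), Real.zero_rpow hq.ne']; positivity
  · have hy' : 0 < y := hc.trans h
    rw [max_eq_left (by linarith)]
    calc (y - c) ^ q ≤ y ^ q := Real.rpow_le_rpow (by linarith) (by linarith) hq.le
      _ = y ^ m * y ^ (q - m) := by rw [← Real.rpow_add hy']; congr 1; ring
      _ ≤ _ := mul_le_mul_of_nonneg_left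
        (Real.rpow_le_rpow_of_nonpos hc h.le (by linarith)) (by positivity)

/-! ### Moments, independence and Rosenthal's inequality -/

lemma rpow_mul_rpow_le_add {a b s t p : ℝ} (ha : 0 ≤ a) (hb : 0 ≤ b) (hs : 0 ≤ s) (ht : 0 ≤ t)
    (hst : s + t = p) : a ^ s * b ^ t ≤ a ^ p + b ^ p := by
  have hm : 0 ≤ max a b := ha.trans (le_max_left _ _)
  calc a ^ s * b ^ t ≤ max a b ^ s * max a b ^ t := by
        gcongr
        · exact le_max_left _ _
        · exact le_max_right _ _
    _ = max a b ^ p := by rw [← Real.rpow_add_of_nonneg hm hs ht, hst]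
    _ ≤ _ := by
        have h1 : 0 ≤ a ^ p := by positivity
        have h2 : 0 ≤ b ^ p := by positivity
        rcases max_cases a b with ⟨h, -⟩ | ⟨h, -⟩ <;> rw [h] <;> linarith

lemma memLp_ofReal_of_integrable {Ω : Type*} [MeasurableSpace Ω] {μ : Measure Ω} {H : Type*}
    [NormedAddCommGroup H] {X : Ω → H} {p : ℝ} (hX : AEStronglyMeasurable X μ) (hp : 0 < p)
    (h : Integrable (fun ω => ‖X ω‖ ^ p) μ) : MemLp X (ENNReal.ofReal p) μ := by
  rw [← integrable_norm_rpow_iff hX (by simpa using hp) ENNReal.ofReal_ne_top,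
    ENNReal.toReal_ofReal hp.le]
  exact h

section Moments

variable {Ω : Type*} [MeasurableSpace Ω] {μ : Measure Ω} [IsProbabilityMeasure μ]
  {H : Type*} [NormedAddCommGroup H]

lemma integrable_rpow_of_memLp {X : Ω → H} {p q : ℝ} (h : MemLp X (ENNReal.ofReal p) μ)
    (hq : 0 ≤ q) (hqp : q ≤ p) : Integrable (fun ω => ‖X ω‖ ^ q) μ := by
  have := (h.mono_exponent (ENNReal.ofReal_le_ofReal hqp)).integrable_norm_rpow'
  rwa [ENNReal.toReal_ofReal hq] at this

lemma integrable_sq_of_memLp {X : Ω → H} {p : ℝ} (h : MemLp X (ENNReal.ofReal p) μ)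
    (hp : 2 ≤ p) : Integrable (fun ω => ‖X ω‖ ^ 2) μ := by
  have := integrable_rpow_of_memLp h zero_le_two hp
  simpa only [Real.rpow_two] using this

/-- Jensen's inequality for powers. -/
lemma integral_rpow_le_rpow {f : Ω → ℝ} {q p : ℝ} (hf : ∀ ω, 0 ≤ f ω) (hq : 0 < q) (hqp : q ≤ p)
    (hi : Integrable (fun ω => f ω ^ q) μ) (hi' : Integrable (fun ω => f ω ^ p) μ) :
    ∫ ω, f ω ^ q ∂μ ≤ (∫ ω, f ω ^ p ∂μ) ^ (q / p) := by
  have hp : 0 < p := hq.trans_le hqp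
  have e : ∀ ω, (f ω ^ q) ^ (p / q) = f ω ^ p := fun ω => by
    rw [← Real.rpow_mul (hf ω), mul_div_cancel₀ _ hq.ne']
  have h1 : 1 ≤ p / q := (one_le_div hq).2 hqp
  have h := (convexOn_rpow h1).map_integral_le
    (Real.continuous_rpow_const (by linarith)).continuousOn isClosed_Ici
    (ae_of_all μ fun ω => Set.mem_Ici.2 (Real.rpow_nonneg (hf ω) q)) hi
    (by simpa only [Function.comp_def, e] using hi')
  simp only [e] at h
  have h0 : 0 ≤ ∫ ω, f ω ^ q ∂μ := integral_nonneg fun ω => Real.rpow_nonneg (hf ω) q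
  calc ∫ ω, f ω ^ q ∂μ = ((∫ ω, f ω ^ q ∂μ) ^ (p / q)) ^ (q / p) := by
        rw [← Real.rpow_mul h0, div_mul_div_cancel₀ hq.ne', div_self hp.ne', Real.rpow_one]
    _ ≤ _ := Real.rpow_le_rpow (by positivity) h (by positivity)

/-- Young-type integrability of mixed products of norms. -/
lemma integrable_rpow_mul_rpow {G : Type*} [NormedAddCommGroup G] {X : Ω → H} {Y : Ω → G}
    {s t p : ℝ} (hX : MemLp X (ENNReal.ofReal p) μ) (hY : MemLp Y (ENNReal.ofReal p) μ)
    (hs : 0 ≤ s) (ht : 0 ≤ t) (hst : s + t = p) (hp : 0 < p) :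
    Integrable (fun ω => ‖X ω‖ ^ s * ‖Y ω‖ ^ t) μ := by
  refine ((integrable_rpow_of_memLp hX hp.le le_rfl).add
    (integrable_rpow_of_memLp hY hp.le le_rfl)).mono' ?_ (ae_of_all μ fun ω => ?_)
  · exact ((hX.1.norm.aemeasurable.pow_const s).mul
      (hY.1.norm.aemeasurable.pow_const t)).aestronglyMeasurable
  · rw [Real.norm_of_nonneg (by positivity)]
    exact rpow_mul_rpow_le_add (norm_nonneg _) (norm_nonneg _) hs ht hst

lemma integrable_rpow_mul_inner [InnerProductSpace ℝ H] {Z D : Ω → H} {p : ℝ} (hp : 2 < p)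
    (hZ : MemLp Z (ENNReal.ofReal p) μ) (hD : MemLp D (ENNReal.ofReal p) μ) :
    Integrable (fun ω => ‖Z ω‖ ^ (p - 2) * inner ℝ (Z ω) (D ω)) μ := by
  refine (integrable_rpow_mul_rpow (s := p - 1) (t := 1) hZ hD (by linarith) zero_le_one (by ring)
    (by linarith)).mono' ?_ (ae_of_all μ fun ω => ?_)
  · exact (hZ.1.norm.aemeasurable.pow_const _).aestronglyMeasurable.mul (hZ.1.inner hD.1)
  · rw [norm_mul, Real.norm_of_nonneg (by positivity), Real.rpow_one]
    have e : ‖Z ω‖ ^ (p - 1) = ‖Z ω‖ ^ (p - 2) * ‖Z ω‖ := by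
      rw [← Real.rpow_add_one' (norm_nonneg _) (by linarith)]; congr 1; ring
    rw [e, mul_assoc]
    exact mul_le_mul_of_nonneg_left (norm_inner_le_norm _ _) (by positivity)

lemma integrable_rpow_mul_sq {Z D : Ω → H} {p : ℝ} (hp : 2 < p)
    (hZ : MemLp Z (ENNReal.ofReal p) μ) (hD : MemLp D (ENNReal.ofReal p) μ) :
    Integrable (fun ω => ‖Z ω‖ ^ (p - 2) * ‖D ω‖ ^ 2) μ := by
  have := integrable_rpow_mul_rpow (s := p - 2) (t := 2) hZ hD (by linarith) zero_le_two (by ring)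
    (by linarith)
  simpa only [Real.rpow_two] using this

/-- One step of a moment recursion: adding an increment orthogonal to the gradient of
`‖·‖ ^ p` costs only second order terms. -/
lemma exists_integral_norm_add_rpow_le {p : ℝ} (hp : 2 < p) :
    ∃ C : ℝ, 0 ≤ C ∧ ∀ {Ω : Type*} [MeasurableSpace Ω] {μ : Measure Ω} [IsProbabilityMeasure μ]
      {H : Type*} [NormedAddCommGroup H] [InnerProductSpace ℝ H] {Z D : Ω → H},
      MemLp Z (ENNReal.ofReal p) μ → MemLp D (ENNReal.ofReal p) μ →
      ∫ ω, ‖Z ω‖ ^ (p - 2) * inner ℝ (Z ω) (D ω) ∂μ = 0 →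
      ∫ ω, ‖Z ω + D ω‖ ^ p ∂μ ≤ ∫ ω, ‖Z ω‖ ^ p ∂μ
        + C * (∫ ω, ‖Z ω‖ ^ (p - 2) * ‖D ω‖ ^ 2 ∂μ + ∫ ω, ‖D ω‖ ^ p ∂μ) := by
  obtain ⟨C, hC, h⟩ := exists_norm_add_rpow_le hp.le
  refine ⟨C, hC, fun {Ω _ μ _ H _ _ Z D} hZ hD h0 => ?_⟩
  have hp0 : 0 ≤ p := by linarith
  have i1 := integrable_rpow_of_memLp hZ hp0 le_rfl
  have i2 := integrable_rpow_of_memLp hD hp0 le_rfl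
  have i3 := integrable_rpow_mul_inner hp hZ hD
  have i4 := integrable_rpow_mul_sq hp hZ hD
  calc ∫ ω, ‖Z ω + D ω‖ ^ p ∂μ
      ≤ ∫ ω, (‖Z ω‖ ^ p + p * (‖Z ω‖ ^ (p - 2) * inner ℝ (Z ω) (D ω))
          + C * (‖Z ω‖ ^ (p - 2) * ‖D ω‖ ^ 2 + ‖D ω‖ ^ p)) ∂μ :=
        integral_mono (integrable_rpow_of_memLp (hZ.add hD) hp0 le_rfl)
          ((i1.add (i3.const_mul p)).add ((i4.add i2).const_mul C)) fun ω => h _ _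
    _ = _ := by
        rw [integral_add (i1.fun_add (i3.const_mul p)) ((i4.fun_add i2).const_mul C),
          integral_add i1 (i3.const_mul p), integral_const_mul, h0, mul_zero, add_zero,
          integral_const_mul, integral_add i4 i2]

end Moments

section Independence

variable {Ω : Type*} [MeasurableSpace Ω] {μ : Measure Ω} [IsProbabilityMeasure μ]

/-- Fubini's theorem for a function of two independent random variables. -/
lemma integral_comp_of_indepFun {E F : Type*} [MeasurableSpace E] [MeasurableSpace F]
    {Y : Ω → E} {X : Ω → F} (h : IndepFun Y X μ) (hY : Measurable Y) (hX : Measurable X)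
    {g : E → F → ℝ} (hg : Measurable (Function.uncurry g))
    (hi : Integrable (fun ω => g (Y ω) (X ω)) μ) :
    Integrable (fun ω' => ∫ ω, g (Y ω) (X ω') ∂μ) μ ∧
      ∫ ω, g (Y ω) (X ω) ∂μ = ∫ ω', ∫ ω, g (Y ω) (X ω') ∂μ ∂μ := by
  have hmap := (indepFun_iff_map_prod_eq_prod_map_map hY.aemeasurable hX.aemeasurable).1 h
  have := Measure.isProbabilityMeasure_map (μ := μ) hY.aemeasurable
  have := Measure.isProbabilityMeasure_map (μ := μ) hX.aemeasurable
  have hYX : Measurable fun ω => (Y ω, X ω) := hY.prodMk hX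
  have hi' : Integrable (Function.uncurry g) ((μ.map Y).prod (μ.map X)) := by
    rw [← hmap, integrable_map_measure hg.aestronglyMeasurable hYX.aemeasurable]
    exact hi
  have inner_eq : ∀ x, ∫ y, g y x ∂(μ.map Y) = ∫ ω, g (Y ω) x ∂μ := fun x =>
    integral_map hY.aemeasurable (hg.comp measurable_prodMk_right).aestronglyMeasurable
  have hr := hi'.integral_prod_right
  simp only [Function.uncurry_apply_pair, inner_eq] at hr
  refine ⟨(integrable_map_measure hr.1 hX.aemeasurable).1 hr, ?_⟩
  calc ∫ ω, g (Y ω) (X ω) ∂μ = ∫ z, Function.uncurry g z ∂(μ.map fun ω => (Y ω, X ω)) :=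
        (integral_map hYX.aemeasurable hg.aestronglyMeasurable).symm
    _ = _ := by
        rw [hmap, integral_prod_symm _ hi']
        simp only [Function.uncurry_apply_pair, inner_eq]
        exact integral_map hX.aemeasurable hr.1

variable {H : Type*} [NormedAddCommGroup H] [InnerProductSpace ℝ H] [CompleteSpace H]
  [MeasurableSpace H] [BorelSpace H] [SecondCountableTopology H]

lemma integral_inner_eq_zero_of_indepFun {U X : Ω → H} (h : IndepFun U X μ) (hU : Measurable U)
    (hX : Measurable X) (hXi : Integrable X μ) (hX0 : ∫ ω, X ω ∂μ = 0)
    (hi : Integrable (fun ω => inner ℝ (U ω) (X ω)) μ) :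
    ∫ ω, inner ℝ (U ω) (X ω) ∂μ = 0 := by
  have hg : Measurable (Function.uncurry fun x u : H => inner ℝ u x) :=
    measurable_snd.inner measurable_fst
  rw [(integral_comp_of_indepFun h.symm hX hU (g := fun x u => inner ℝ u x) hg hi).2]
  simp [integral_inner hXi, hX0]

/-- **Rosenthal's inequality** for sums of independent centred random vectors of a Hilbert
space. -/
theorem exists_rosenthal {p : ℝ} (hp : 2 < p) :
    ∃ K : ℝ, 0 ≤ K ∧ ∀ {Ω : Type*} [MeasurableSpace Ω] {μ : Measure Ω} [IsProbabilityMeasure μ]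
      {H : Type*} [NormedAddCommGroup H] [InnerProductSpace ℝ H] [CompleteSpace H]
      [MeasurableSpace H] [BorelSpace H] [SecondCountableTopology H]
      {ι : Type*} {X : ι → Ω → H}, (∀ i, Measurable (X i)) → iIndepFun X μ →
      (∀ i, MemLp (X i) (ENNReal.ofReal p) μ) → (∀ i, ∫ ω, X i ω ∂μ = 0) → ∀ s : Finset ι,
      ∫ ω, ‖∑ i ∈ s, X i ω‖ ^ p ∂μ ≤
        K * ((∑ i ∈ s, ∫ ω, ‖X i ω‖ ^ 2 ∂μ) ^ (p / 2) + ∑ i ∈ s, ∫ ω, ‖X i ω‖ ^ p ∂μ) := by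
  obtain ⟨C, hC, h⟩ := exists_integral_norm_add_rpow_le hp
  refine ⟨(2 * C) ^ (p / 2) + 2 * C, by positivity,
    fun {Ω _ μ _ H _ _ _ _ _ _ ι X} hX hind hL h0 s => ?_⟩
  classical
  have hp0 : 0 < p := by linarith
  have hp1 : (1 : ENNReal) ≤ ENNReal.ofReal p := by
    rw [ENNReal.one_le_ofReal]; linarith
  refine rpow_le_of_insert_le hp hC (fun u => ∫ ω, ‖∑ i ∈ u, X i ω‖ ^ p ∂μ)
    (fun i => ∫ ω, ‖X i ω‖ ^ 2 ∂μ) (fun i => ∫ ω, ‖X i ω‖ ^ p ∂μ)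
    (fun u => integral_nonneg fun ω => by positivity) (by simp [Real.zero_rpow hp0.ne'])
    (fun i => integral_nonneg fun ω => by positivity)
    (fun i => integral_nonneg fun ω => by positivity) (fun u i hi => ?_) s
  have hS : MemLp (fun ω => ∑ j ∈ u, X j ω) (ENNReal.ofReal p) μ :=
    memLp_finsetSum u fun j _ => hL j
  have hSm : Measurable fun ω => ∑ j ∈ u, X j ω := Finset.measurable_fun_sum u fun j _ => hX j
  have hSX : IndepFun (fun ω => ∑ j ∈ u, X j ω) (X i) μ := by
    have := hind.indepFun_finsetSum_of_notMem hX hi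
    convert this using 1
    ext ω; simp
  simp only [Finset.sum_insert hi]
  simp only [add_comm (X i _)]
  have hcross : ∫ ω, ‖∑ j ∈ u, X j ω‖ ^ (p - 2) * inner ℝ (∑ j ∈ u, X j ω) (X i ω) ∂μ = 0 := by
    have e : ∀ ω, ‖∑ j ∈ u, X j ω‖ ^ (p - 2) * inner ℝ (∑ j ∈ u, X j ω) (X i ω)
        = inner ℝ (‖∑ j ∈ u, X j ω‖ ^ (p - 2) • ∑ j ∈ u, X j ω) (X i ω) := fun ω => by
      rw [real_inner_smul_left]
    have hφ : Measurable fun x : H => ‖x‖ ^ (p - 2) • x :=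
      (measurable_norm.pow_const _).smul measurable_id
    have hii := integrable_rpow_mul_inner hp hS (hL i)
    simp only [e] at hii ⊢
    exact integral_inner_eq_zero_of_indepFun (hSX.comp hφ measurable_id) (hφ.comp hSm) (hX i)
      ((hL i).integrable hp1) (h0 i) hii
  refine (h hS (hL i) hcross).trans ?_
  have hprod : ∫ ω, ‖∑ j ∈ u, X j ω‖ ^ (p - 2) * ‖X i ω‖ ^ 2 ∂μ
      = (∫ ω, ‖∑ j ∈ u, X j ω‖ ^ (p - 2) ∂μ) * ∫ ω, ‖X i ω‖ ^ 2 ∂μ :=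
    (hSX.comp (φ := fun x => ‖x‖ ^ (p - 2)) (ψ := fun x => ‖x‖ ^ 2)
      (measurable_norm.pow_const _) (measurable_norm.pow_const _)).integral_fun_mul_eq_mul_integral
      (hSm.norm.pow_const _).aestronglyMeasurable ((hX i).norm.pow_const _).aestronglyMeasurable
  have hjen : ∫ ω, ‖∑ j ∈ u, X j ω‖ ^ (p - 2) ∂μ
      ≤ (∫ ω, ‖∑ j ∈ u, X j ω‖ ^ p ∂μ) ^ (1 - 2 / p) := by
    have := integral_rpow_le_rpow (μ := μ) (f := fun ω => ‖∑ j ∈ u, X j ω‖) (q := p - 2) (p := p)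
      (fun ω => norm_nonneg _) (by linarith) (by linarith)
      (integrable_rpow_of_memLp hS (by linarith) (by linarith))
      (integrable_rpow_of_memLp hS hp0.le le_rfl)
    rwa [sub_div, div_self hp0.ne'] at this
  rw [hprod]
  have hv : 0 ≤ ∫ ω, ‖X i ω‖ ^ 2 ∂μ := integral_nonneg fun ω => by positivity
  gcongr

end Independence

/-! ### The off-diagonal part of a squared norm -/

/-- Hölder's inequality with exponents `p / (p - 2)` and `p / 2`. -/
lemma integral_rpow_mul_sq_le {Ω : Type*} [MeasurableSpace Ω] {μ : Measure Ω}
    [IsProbabilityMeasure μ] {H G : Type*} [NormedAddCommGroup H] [NormedAddCommGroup G]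
    {Z : Ω → H} {D : Ω → G} {p : ℝ} (hp : 2 < p)
    (hZ : MemLp Z (ENNReal.ofReal p) μ) (hD : MemLp D (ENNReal.ofReal p) μ) :
    ∫ ω, ‖Z ω‖ ^ (p - 2) * ‖D ω‖ ^ 2 ∂μ ≤
      (∫ ω, ‖Z ω‖ ^ p ∂μ) ^ (1 - 2 / p) * (∫ ω, ‖D ω‖ ^ p ∂μ) ^ (2 / p) := by
  have hp0 : 0 < p := by linarith
  have hp2 : 0 < p - 2 := by linarith
  have eZ : ∀ ω, (‖Z ω‖ ^ (p - 2)) ^ (p / (p - 2)) = ‖Z ω‖ ^ p := fun ω => by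
    rw [← Real.rpow_mul (norm_nonneg _), mul_div_cancel₀ _ hp2.ne']
  have eD : ∀ ω, (‖D ω‖ ^ 2) ^ (p / 2) = ‖D ω‖ ^ p := fun ω => by
    rw [← Real.rpow_two, ← Real.rpow_mul (norm_nonneg _), mul_div_cancel₀ _ two_ne_zero]
  have hconj : (p / (p - 2)).HolderConjugate (p / 2) := by
    rw [Real.holderConjugate_iff]
    refine ⟨(one_lt_div hp2).2 (by linarith), ?_⟩
    field_simp; ring
  have mZ : MemLp (fun ω => ‖Z ω‖ ^ (p - 2)) (ENNReal.ofReal (p / (p - 2))) μ := by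
    refine memLp_ofReal_of_integrable
      (hZ.1.norm.aemeasurable.pow_const _).aestronglyMeasurable (by positivity) ?_
    have : ∀ ω, ‖‖Z ω‖ ^ (p - 2)‖ = ‖Z ω‖ ^ (p - 2) := fun ω =>
      Real.norm_of_nonneg (by positivity)
    simpa only [this, eZ] using integrable_rpow_of_memLp hZ hp0.le le_rfl
  have mD : MemLp (fun ω => ‖D ω‖ ^ 2) (ENNReal.ofReal (p / 2)) μ := by
    refine memLp_ofReal_of_integrable
      (hD.1.norm.aemeasurable.pow_const _).aestronglyMeasurable (by positivity) ?_
    have : ∀ ω, ‖‖D ω‖ ^ 2‖ = ‖D ω‖ ^ 2 := fun ω => Real.norm_of_nonneg (by positivity)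
    simpa only [this, eD] using integrable_rpow_of_memLp hD hp0.le le_rfl
  have := integral_mul_le_Lp_mul_Lq_of_nonneg hconj
    (ae_of_all μ fun ω => by positivity) (ae_of_all μ fun ω => by positivity) mZ mD
  simp only [eZ, eD, one_div_div] at this
  rwa [sub_div, div_self hp0.ne'] at this

/-- The inner product of two independent vectors has as many moments as each of them. -/
lemma memLp_inner_of_indepFun {Ω : Type*} [MeasurableSpace Ω] {μ : Measure Ω}
    [IsProbabilityMeasure μ] {H : Type*} [NormedAddCommGroup H] [InnerProductSpace ℝ H]
    [MeasurableSpace H] [BorelSpace H] {S X : Ω → H} {p : ℝ} (hp : 0 < p) (h : IndepFun S X μ)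
    (hS : MemLp S (ENNReal.ofReal p) μ) (hX : MemLp X (ENNReal.ofReal p) μ) :
    MemLp (fun ω => inner ℝ (S ω) (X ω)) (ENNReal.ofReal p) μ ∧
      ∫ ω, ‖inner ℝ (S ω) (X ω)‖ ^ p ∂μ ≤ (∫ ω, ‖S ω‖ ^ p ∂μ) * ∫ ω, ‖X ω‖ ^ p ∂μ := by
  have hind := h.comp (φ := fun x => ‖x‖ ^ p) (ψ := fun x => ‖x‖ ^ p)
      (measurable_norm.pow_const _) (measurable_norm.pow_const _)
  have iS := integrable_rpow_of_memLp hS hp.le le_rfl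
  have iX := integrable_rpow_of_memLp hX hp.le le_rfl
  have hi : Integrable (fun ω => ‖S ω‖ ^ p * ‖X ω‖ ^ p) μ := hind.integrable_mul iS iX
  have hle : ∀ ω, ‖inner ℝ (S ω) (X ω)‖ ^ p ≤ ‖S ω‖ ^ p * ‖X ω‖ ^ p := fun ω => by
    rw [← Real.mul_rpow (norm_nonneg _) (norm_nonneg _)]
    exact Real.rpow_le_rpow (norm_nonneg _) (norm_inner_le_norm _ _) hp.le
  have hm : AEStronglyMeasurable (fun ω => inner ℝ (S ω) (X ω)) μ := hS.1.inner hX.1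
  have hi' : Integrable (fun ω => ‖inner ℝ (S ω) (X ω)‖ ^ p) μ :=
    hi.mono' (hm.norm.aemeasurable.pow_const _).aestronglyMeasurable (ae_of_all μ fun ω => by
      rw [Real.norm_of_nonneg (by positivity)]; exact hle ω)
  refine ⟨memLp_ofReal_of_integrable hm hp hi', (integral_mono hi' hi hle).trans (le_of_eq ?_)⟩
  exact hind.integral_fun_mul_eq_mul_integral iS.1 iX.1

section OffDiagonal

variable {Ω : Type*} {H : Type*} [NormedAddCommGroup H]

/-- The off-diagonal part `∑ i ≠ j, ⟪X i, X j⟫` of `‖∑ i, X i‖ ^ 2`, for indices in `u`. -/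
noncomputable def offDiag {ι : Type*} (X : ι → Ω → H) (u : Finset ι) (ω : Ω) : ℝ :=
  ‖∑ i ∈ u, X i ω‖ ^ 2 - ∑ i ∈ u, ‖X i ω‖ ^ 2

lemma offDiag_insert [InnerProductSpace ℝ H] {ι : Type*} [DecidableEq ι] (X : ι → Ω → H)
    {u : Finset ι} {i : ι} (hi : i ∉ u) (ω : Ω) :
    offDiag X (insert i u) ω = offDiag X u ω + 2 * inner ℝ (∑ j ∈ u, X j ω) (X i ω) := by
  simp only [offDiag, Finset.sum_insert hi]
  rw [add_comm (X i ω), norm_add_sq_real]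
  ring

variable [MeasurableSpace Ω] [MeasurableSpace H] [BorelSpace H] [SecondCountableTopology H]

lemma measurable_offDiag {ι : Type*} {X : ι → Ω → H} (hX : ∀ i, Measurable (X i))
    (u : Finset ι) : Measurable (offDiag X u) :=
  ((Finset.measurable_fun_sum u fun j _ => hX j).norm.pow_const 2).sub
    (Finset.measurable_fun_sum u fun j _ => (hX j).norm.pow_const 2)

lemma indepFun_sum_offDiag {μ : Measure Ω} {ι : Type*} {X : ι → Ω → H} (hX : ∀ i, Measurable (X i))
    (hind : iIndepFun X μ) {u : Finset ι} {i : ι} (hi : i ∉ u) :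
    IndepFun (fun ω => (∑ j ∈ u, X j ω, offDiag X u ω)) (X i) μ := by
  have h := hind.indepFun_finset u {i} (Finset.disjoint_singleton_right.2 hi) hX
  have hφ : Measurable fun x : u → H => (∑ j, x j, ‖∑ j, x j‖ ^ 2 - ∑ j, ‖x j‖ ^ 2) := by
    fun_prop
  have hψ : Measurable fun x : ({i} : Finset ι) → H => x ⟨i, Finset.mem_singleton_self i⟩ :=
    measurable_pi_apply _
  have := h.comp hφ hψ
  have e : (fun ω => (∑ j ∈ u, X j ω, offDiag X u ω)) =
      (fun x : u → H => (∑ j, x j, ‖∑ j, x j‖ ^ 2 - ∑ j, ‖x j‖ ^ 2)) ∘ fun ω j => X j ω := by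
    ext ω : 1
    simp only [Function.comp_apply, offDiag]
    rw [Finset.sum_coe_sort u fun j => X j ω, Finset.sum_coe_sort u fun j => ‖X j ω‖ ^ 2]
  rw [e]
  exact this

lemma memLp_offDiag {μ : Measure Ω} [IsProbabilityMeasure μ] [InnerProductSpace ℝ H] {ι : Type*} {X : ι → Ω → H} (hX : ∀ i, Measurable (X i))
    (hind : iIndepFun X μ) {p : ℝ} (hp : 0 < p) (hL : ∀ i, MemLp (X i) (ENNReal.ofReal p) μ)
    (u : Finset ι) : MemLp (offDiag X u) (ENNReal.ofReal p) μ := by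
  classical
  induction u using Finset.induction_on with
  | empty => simp [show offDiag X ∅ = 0 by ext; simp [offDiag]]
  | insert i u hi ih =>
    have h := (indepFun_sum_offDiag hX hind hi).comp (φ := Prod.fst) measurable_fst measurable_id
    have := (memLp_inner_of_indepFun hp h (memLp_finsetSum u fun j _ => hL j) (hL i)).1
    exact (ih.add (this.const_mul 2)).congr_norm (measurable_offDiag hX _).aestronglyMeasurable
      (ae_of_all μ fun ω => by rw [offDiag_insert X hi]; rfl)

end OffDiagonal

/-- Weak moments of partial sums of independent centred vectors. -/
lemma exists_integral_inner_sum_le {p : ℝ} (hp : 2 < p) :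
    ∃ R : ℝ, 0 ≤ R ∧ ∀ {Ω : Type*} [MeasurableSpace Ω] {μ : Measure Ω} [IsProbabilityMeasure μ]
      {H : Type*} [NormedAddCommGroup H] [InnerProductSpace ℝ H] [CompleteSpace H]
      [MeasurableSpace H] [BorelSpace H] [SecondCountableTopology H]
      {ι : Type*} [Fintype ι] {X : ι → Ω → H}, (∀ i, Measurable (X i)) → iIndepFun X μ →
      (∀ i, MemLp (X i) (ENNReal.ofReal p) μ) → (∀ i, ∫ ω, X i ω ∂μ = 0) →
      ∀ {A : ℝ}, ∑ i, ∫ ω, ‖X i ω‖ ^ p ∂μ ≤ A →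
      (∀ x : H, ∑ i, ∫ ω, inner ℝ x (X i ω) ^ 2 ∂μ ≤ A ^ (2 / p) * ‖x‖ ^ 2) →
      ∀ (u : Finset ι) (x : H), (∫ ω, ‖inner ℝ x (∑ j ∈ u, X j ω)‖ ^ p ∂μ) ^ (2 / p)
        ≤ (2 * R * A) ^ (2 / p) * ‖x‖ ^ 2 := by
  obtain ⟨R, hR, hRos⟩ := exists_rosenthal hp
  refine ⟨R, hR, fun {Ω _ μ _ H _ _ _ _ _ _ ι _ X} hX hind hL h0 A hA hw u x => ?_⟩
  have hp0 : 0 < p := by linarith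
  have hp1 : (1 : ENNReal) ≤ ENNReal.ofReal p := by
    rw [ENNReal.one_le_ofReal]; linarith
  have hA0 : 0 ≤ A := (Finset.sum_nonneg fun i _ =>
    integral_nonneg fun ω => by positivity).trans hA
  have hLx : ∀ i, MemLp (fun ω => inner ℝ x (X i ω)) (ENNReal.ofReal p) μ :=
    fun i => (hL i).const_inner x
  have h1 := hRos (X := fun i ω => inner ℝ x (X i ω)) (fun i => measurable_const.inner (hX i))
    (hind.comp (fun _ y => inner ℝ x y) fun _ => measurable_const.inner measurable_id) hLx
    (fun i => by rw [integral_inner ((hL i).integrable hp1), h0 i, inner_zero_right]) u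
  simp only [← inner_sum] at h1
  have h2 : ∑ i ∈ u, ∫ ω, ‖inner ℝ x (X i ω)‖ ^ 2 ∂μ ≤ A ^ (2 / p) * ‖x‖ ^ 2 := by
    simp only [Real.norm_eq_abs, sq_abs]
    exact (Finset.sum_le_univ_sum_of_nonneg fun i =>
      integral_nonneg fun ω => sq_nonneg _).trans (hw x)
  have h3 : ∑ i ∈ u, ∫ ω, ‖inner ℝ x (X i ω)‖ ^ p ∂μ ≤ ‖x‖ ^ p * A := by
    refine (Finset.sum_le_univ_sum_of_nonneg fun i =>
      integral_nonneg fun ω => by positivity).trans ?_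
    refine le_trans ?_ (mul_le_mul_of_nonneg_left hA (by positivity))
    rw [Finset.mul_sum]
    refine Finset.sum_le_sum fun i _ => ?_
    rw [← integral_const_mul]
    refine integral_mono (integrable_rpow_of_memLp (hLx i) hp0.le le_rfl)
      ((integrable_rpow_of_memLp (hL i) hp0.le le_rfl).const_mul _) fun ω => ?_
    rw [← Real.mul_rpow (norm_nonneg _) (norm_nonneg _)]
    exact Real.rpow_le_rpow (norm_nonneg _) (norm_inner_le_norm _ _) hp0.le
  have h4 : (A ^ (2 / p) * ‖x‖ ^ 2) ^ (p / 2) = ‖x‖ ^ p * A := by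
    rw [Real.mul_rpow (by positivity) (by positivity), ← Real.rpow_mul hA0,
      ← Real.rpow_two, ← Real.rpow_mul (norm_nonneg _), div_mul_div_cancel₀ hp0.ne',
      div_self two_ne_zero, Real.rpow_one, mul_div_cancel₀ _ two_ne_zero, mul_comm]
  have h5 : ∫ ω, ‖inner ℝ x (∑ j ∈ u, X j ω)‖ ^ p ∂μ ≤ 2 * R * A * ‖x‖ ^ p := by
    refine h1.trans ?_
    have h6 := Real.rpow_le_rpow (Finset.sum_nonneg fun i _ =>
      integral_nonneg fun ω => by positivity) h2 (by positivity : 0 ≤ p / 2)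
    rw [h4] at h6
    nlinarith [mul_le_mul_of_nonneg_left (add_le_add h6 h3) hR]
  calc _ ≤ (2 * R * A * ‖x‖ ^ p) ^ (2 / p) :=
        Real.rpow_le_rpow (integral_nonneg fun ω => by positivity) h5 (by positivity)
    _ = _ := by
        rw [Real.mul_rpow (by positivity) (by positivity), ← Real.rpow_mul (norm_nonneg _),
          mul_div_cancel₀ _ hp0.ne', Real.rpow_two]

section Step

variable {Ω : Type*} [MeasurableSpace Ω] {μ : Measure Ω} [IsProbabilityMeasure μ]
  {H : Type*} [NormedAddCommGroup H] [InnerProductSpace ℝ H]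
  [MeasurableSpace H] [BorelSpace H] [SecondCountableTopology H]
  {S X : Ω → H} {O : Ω → ℝ} {p : ℝ}

lemma integral_rpow_mul_inner_mul_eq_zero [CompleteSpace H] (hp : 2 < p)
    (hSm : Measurable S) (hOm : Measurable O) (hXm : Measurable X)
    (hind : IndepFun (fun ω => (S ω, O ω)) X μ) (hO : MemLp O (ENNReal.ofReal p) μ)
    (hX : MemLp X (ENNReal.ofReal p) μ) (h0 : ∫ ω, X ω ∂μ = 0)
    (hD : MemLp (fun ω => 2 * inner ℝ (S ω) (X ω)) (ENNReal.ofReal p) μ) :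
    ∫ ω, ‖O ω‖ ^ (p - 2) * inner ℝ (O ω) (2 * inner ℝ (S ω) (X ω)) ∂μ = 0 := by
  have e : ∀ ω, ‖O ω‖ ^ (p - 2) * inner ℝ (O ω) (2 * inner ℝ (S ω) (X ω))
      = inner ℝ ((‖O ω‖ ^ (p - 2) * O ω * 2) • S ω) (X ω) := fun ω => by
    rw [real_inner_smul_left, RCLike.inner_apply, conj_trivial]; ring
  have hφ : Measurable fun z : H × ℝ => (‖z.2‖ ^ (p - 2) * z.2 * 2) • z.1 :=
    (((measurable_snd.norm.pow_const _).mul measurable_snd).mul_const 2).smul measurable_fst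
  have hii := integrable_rpow_mul_inner hp hO hD
  simp only [e] at hii ⊢
  have hp1 : (1 : ENNReal) ≤ ENNReal.ofReal p := by
    rw [ENNReal.one_le_ofReal]; linarith
  exact integral_inner_eq_zero_of_indepFun (hind.comp hφ measurable_id)
    (hφ.comp (hSm.prodMk hOm)) hXm (hX.integrable hp1) h0 hii

/-- Hölder's inequality is applied for each frozen value of `X`, so that only the weak moments
of `S` enter. -/
lemma integral_rpow_mul_inner_sq_le (hp : 2 < p)
    (hSm : Measurable S) (hOm : Measurable O) (hXm : Measurable X)
    (hind : IndepFun (fun ω => (S ω, O ω)) X μ) (hO : MemLp O (ENNReal.ofReal p) μ)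
    (hS : MemLp S (ENNReal.ofReal p) μ) (hX : MemLp X (ENNReal.ofReal p) μ)
    (hD : MemLp (fun ω => 2 * inner ℝ (S ω) (X ω)) (ENNReal.ofReal p) μ) {B : ℝ}
    (hB : ∀ x : H, (∫ ω, ‖inner ℝ x (S ω)‖ ^ p ∂μ) ^ (2 / p) ≤ B * ‖x‖ ^ 2) :
    ∫ ω, ‖O ω‖ ^ (p - 2) * ‖2 * inner ℝ (S ω) (X ω)‖ ^ 2 ∂μ
      ≤ (∫ ω, ‖O ω‖ ^ p ∂μ) ^ (1 - 2 / p) * (4 * B * ∫ ω, ‖X ω‖ ^ 2 ∂μ) := by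
  have hg : Measurable (Function.uncurry fun (z : H × ℝ) (x : H) =>
      ‖z.2‖ ^ (p - 2) * ‖2 * inner ℝ z.1 x‖ ^ 2) :=
    (measurable_fst.snd.norm.pow_const _).mul
      (((measurable_fst.fst.inner measurable_snd).const_mul 2).norm.pow_const 2)
  obtain ⟨hFi, hFe⟩ := integral_comp_of_indepFun hind (hSm.prodMk hOm) hXm hg
    (integrable_rpow_mul_sq hp hO hD)
  rw [hFe]
  have hx : ∀ x : H, ∫ ω, ‖O ω‖ ^ (p - 2) * ‖2 * inner ℝ (S ω) x‖ ^ 2 ∂μ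
      ≤ (∫ ω, ‖O ω‖ ^ p ∂μ) ^ (1 - 2 / p) * (4 * B * ‖x‖ ^ 2) := by
    intro x
    have hix : MemLp (fun ω => inner ℝ x (S ω)) (ENNReal.ofReal p) μ := hS.const_inner x
    have e : ∀ ω, ‖O ω‖ ^ (p - 2) * ‖2 * inner ℝ (S ω) x‖ ^ 2
        = 4 * (‖O ω‖ ^ (p - 2) * ‖inner ℝ x (S ω)‖ ^ 2) := fun ω => by
      rw [norm_mul, mul_pow, real_inner_comm x]; norm_num; ring
    simp only [e]
    rw [integral_const_mul]
    have h1 := (integral_rpow_mul_sq_le hp hO hix).trans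
      (mul_le_mul_of_nonneg_left (hB x)
        (Real.rpow_nonneg (integral_nonneg fun ω => by positivity) _))
    linarith
  calc _ ≤ ∫ ω', (∫ ω, ‖O ω‖ ^ p ∂μ) ^ (1 - 2 / p) * (4 * B * ‖X ω'‖ ^ 2) ∂μ :=
        integral_mono hFi (((integrable_sq_of_memLp hX hp.le).const_mul _).const_mul _)
          fun ω' => hx (X ω')
    _ = _ := by rw [integral_const_mul, integral_const_mul]

end Step

/-- One step of the moment recursion for the off-diagonal part; `B` bounds the weak moments of
the partial sum. -/
lemma exists_integral_offDiag_insert_le {p : ℝ} (hp : 2 < p) :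
    ∃ C : ℝ, 0 ≤ C ∧ ∀ {Ω : Type*} [MeasurableSpace Ω] {μ : Measure Ω} [IsProbabilityMeasure μ]
      {H : Type*} [NormedAddCommGroup H] [InnerProductSpace ℝ H] [CompleteSpace H]
      [MeasurableSpace H] [BorelSpace H] [SecondCountableTopology H]
      {ι : Type*} [DecidableEq ι] {X : ι → Ω → H}, (∀ i, Measurable (X i)) → iIndepFun X μ →
      (∀ i, MemLp (X i) (ENNReal.ofReal p) μ) → (∀ i, ∫ ω, X i ω ∂μ = 0) →
      ∀ {u : Finset ι} {i : ι} {B : ℝ}, i ∉ u →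
      (∀ x : H, (∫ ω, ‖inner ℝ x (∑ j ∈ u, X j ω)‖ ^ p ∂μ) ^ (2 / p) ≤ B * ‖x‖ ^ 2) →
      ∫ ω, ‖offDiag X (insert i u) ω‖ ^ p ∂μ ≤ ∫ ω, ‖offDiag X u ω‖ ^ p ∂μ +
        C * ((∫ ω, ‖offDiag X u ω‖ ^ p ∂μ) ^ (1 - 2 / p) *
            (4 * B * ∫ ω, ‖X i ω‖ ^ 2 ∂μ)
          + 2 ^ p * (∫ ω, ‖∑ j ∈ u, X j ω‖ ^ p ∂μ) * ∫ ω, ‖X i ω‖ ^ p ∂μ) := by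
  obtain ⟨C, hC, h⟩ := exists_integral_norm_add_rpow_le hp
  refine ⟨C, hC, fun {Ω _ μ _ H _ _ _ _ _ _ ι _ X} hX hind hL h0 u i B hi hB => ?_⟩
  have hp0 : 0 < p := by linarith
  have hS : MemLp (fun ω => ∑ j ∈ u, X j ω) (ENNReal.ofReal p) μ :=
    memLp_finsetSum u fun j _ => hL j
  have hSm : Measurable fun ω => ∑ j ∈ u, X j ω := Finset.measurable_fun_sum u fun j _ => hX j
  have hOm := measurable_offDiag hX u
  have hO := memLp_offDiag hX hind hp0 hL u
  have hSO := indepFun_sum_offDiag hX hind hi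
  have hSX : IndepFun (fun ω => ∑ j ∈ u, X j ω) (X i) μ :=
    hSO.comp (φ := Prod.fst) measurable_fst measurable_id
  simp only [offDiag_insert X hi]
  obtain ⟨hI, hIle⟩ := memLp_inner_of_indepFun hp0 hSX hS (hL i)
  have hD : MemLp (fun ω => 2 * inner ℝ (∑ j ∈ u, X j ω) (X i ω)) (ENNReal.ofReal p) μ :=
    hI.const_mul 2
  have hsecond := integral_rpow_mul_inner_sq_le hp hSm hOm (hX i) hSO hO hS (hL i) hD hB
  have hthird : ∫ ω, ‖2 * inner ℝ (∑ j ∈ u, X j ω) (X i ω)‖ ^ p ∂μ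
      ≤ 2 ^ p * (∫ ω, ‖∑ j ∈ u, X j ω‖ ^ p ∂μ) * ∫ ω, ‖X i ω‖ ^ p ∂μ := by
    have e : ∀ ω, ‖2 * inner ℝ (∑ j ∈ u, X j ω) (X i ω)‖ ^ p
        = 2 ^ p * ‖inner ℝ (∑ j ∈ u, X j ω) (X i ω)‖ ^ p := fun ω => by
      rw [norm_mul, Real.mul_rpow (norm_nonneg _) (norm_nonneg _), Real.norm_two]
    simp only [e]
    rw [integral_const_mul, mul_assoc]
    exact mul_le_mul_of_nonneg_left hIle (by positivity)
  refine (h hO hD (integral_rpow_mul_inner_mul_eq_zero hp hSm hOm (hX i) hSO hO (hL i) (h0 i)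
    hD)).trans ?_
  exact add_le_add_right (mul_le_mul_of_nonneg_left (add_le_add hsecond hthird) hC) _

/-- Moments of the off-diagonal part of `‖∑ i, X i‖ ^ 2`. The decisive point is that the
variance proxy is the weak variance, at most `A ^ (2 / p)`, times the total variance `V`, and not
`V ^ 2`. -/
theorem exists_integral_offDiag_le {p : ℝ} (hp : 2 < p) :
    ∃ K : ℝ, 0 ≤ K ∧ ∀ {Ω : Type*} [MeasurableSpace Ω] {μ : Measure Ω} [IsProbabilityMeasure μ]
      {H : Type*} [NormedAddCommGroup H] [InnerProductSpace ℝ H] [CompleteSpace H]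
      [MeasurableSpace H] [BorelSpace H] [SecondCountableTopology H]
      {ι : Type*} [Fintype ι] {X : ι → Ω → H}, (∀ i, Measurable (X i)) → iIndepFun X μ →
      (∀ i, MemLp (X i) (ENNReal.ofReal p) μ) → (∀ i, ∫ ω, X i ω ∂μ = 0) →
      ∀ {A : ℝ}, ∑ i, ∫ ω, ‖X i ω‖ ^ p ∂μ ≤ A →
      (∀ x : H, ∑ i, ∫ ω, inner ℝ x (X i ω) ^ 2 ∂μ ≤ A ^ (2 / p) * ‖x‖ ^ 2) →
      ∫ ω, |offDiag X Finset.univ ω| ^ p ∂μ ≤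
        K * (A * (∑ i, ∫ ω, ‖X i ω‖ ^ 2 ∂μ) ^ (p / 2) + A ^ 2) := by
  obtain ⟨C, hC, hstep⟩ := exists_integral_offDiag_insert_le hp
  obtain ⟨R, hR, hRos⟩ := exists_rosenthal hp
  obtain ⟨R', hR', hweak⟩ := exists_integral_inner_sum_le hp
  refine ⟨((2 * C) ^ (p / 2) + 2 * C) * (4 ^ (p / 2) * (2 * R') + 2 ^ p * R), by positivity,
    fun {Ω _ μ _ H _ _ _ _ _ _ ι _ X} hX hind hL h0 A hA hw => ?_⟩
  classical
  have hp0 : 0 < p := by linarith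
  have hA0 : 0 ≤ A := (Finset.sum_nonneg fun i _ =>
    integral_nonneg fun ω => by positivity).trans hA
  set V := ∑ i, ∫ ω, ‖X i ω‖ ^ 2 ∂μ with hV
  have hv : ∀ i, 0 ≤ ∫ ω, ‖X i ω‖ ^ 2 ∂μ := fun i => integral_nonneg fun ω => by positivity
  have ha : ∀ i, 0 ≤ ∫ ω, ‖X i ω‖ ^ p ∂μ := fun i => integral_nonneg fun ω => by positivity
  have hV0 : 0 ≤ V := Finset.sum_nonneg fun i _ => hv i
  -- strong moments of the partial sums
  have hstrong : ∀ u : Finset ι, ∫ ω, ‖∑ j ∈ u, X j ω‖ ^ p ∂μ ≤ R * (V ^ (p / 2) + A) :=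
    fun u => (hRos hX hind hL h0 u).trans (mul_le_mul_of_nonneg_left (add_le_add
      (Real.rpow_le_rpow (Finset.sum_nonneg fun i _ => hv i)
        (Finset.sum_le_univ_sum_of_nonneg hv) (by positivity))
      ((Finset.sum_le_univ_sum_of_nonneg ha).trans hA)) hR)
  have key := rpow_le_of_insert_le hp hC (fun u => ∫ ω, ‖offDiag X u ω‖ ^ p ∂μ)
    (fun i => 4 * (2 * R' * A) ^ (2 / p) * ∫ ω, ‖X i ω‖ ^ 2 ∂μ)
    (fun i => 2 ^ p * (R * (V ^ (p / 2) + A)) * ∫ ω, ‖X i ω‖ ^ p ∂μ)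
    (fun u => integral_nonneg fun ω => by positivity)
    (by simp [offDiag, Real.zero_rpow hp0.ne'])
    (fun i => mul_nonneg (by positivity) (hv i)) (fun i => mul_nonneg (by positivity) (ha i))
    (fun u i hi => ?_) Finset.univ
  · simp only [Real.norm_eq_abs] at key
    refine key.trans ?_
    rw [← Finset.mul_sum, ← Finset.mul_sum, mul_assoc ((2 * C) ^ (p / 2) + 2 * C)]
    refine mul_le_mul_of_nonneg_left ?_ (by positivity)
    have e : (4 * (2 * R' * A) ^ (2 / p) * V) ^ (p / 2)
        = 4 ^ (p / 2) * (2 * R' * A) * V ^ (p / 2) := by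
      rw [Real.mul_rpow (by positivity) hV0, Real.mul_rpow (by norm_num) (by positivity),
        ← Real.rpow_mul (by positivity), div_mul_div_cancel₀ hp0.ne', div_self two_ne_zero,
        Real.rpow_one]
    rw [← hV, e]
    have h1 : 2 ^ p * (R * (V ^ (p / 2) + A)) * ∑ i, ∫ ω, ‖X i ω‖ ^ p ∂μ
        ≤ 2 ^ p * (R * (V ^ (p / 2) + A)) * A := mul_le_mul_of_nonneg_left hA (by positivity)
    have h2 : 0 ≤ (4 : ℝ) ^ (p / 2) * (2 * R') * A ^ 2 := by positivity
    nlinarith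
  · refine (hstep hX hind hL h0 hi (hweak hX hind hL h0 hA hw u)).trans ?_
    have h1 := mul_le_mul_of_nonneg_right (mul_le_mul_of_nonneg_left (hstrong u)
      (by positivity : (0 : ℝ) ≤ 2 ^ p)) (ha i)
    gcongr

/-! ### Truncated sums -/

/-- Truncation of a nonnegative number at level `L`: values above `L` are replaced by `0`. -/
noncomputable def truncAt (L y : ℝ) : ℝ := if y ≤ L then y else 0

lemma measurable_truncAt (L : ℝ) : Measurable (truncAt L) :=
  Measurable.ite measurableSet_Iic measurable_id measurable_const

lemma truncAt_nonneg {L y : ℝ} (hy : 0 ≤ y) : 0 ≤ truncAt L y := by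
  unfold truncAt; split_ifs <;> linarith

lemma truncAt_le {L y : ℝ} (hy : 0 ≤ y) : truncAt L y ≤ y := by
  unfold truncAt; split_ifs <;> linarith

lemma truncAt_le_level {L y : ℝ} (hL : 0 ≤ L) : truncAt L y ≤ L := by
  unfold truncAt; split_ifs <;> linarith

/-- The part removed by truncation is controlled by a higher moment. -/
lemma sub_truncAt_rpow_le {L y q m : ℝ} (hy : 0 ≤ y) (hL : 0 < L) (hq : 0 < q) (hm : q ≤ m) :
    (y - truncAt L y) ^ q ≤ y ^ m * L ^ (q - m) := by
  unfold truncAt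
  split_ifs with h
  · rw [sub_self, Real.zero_rpow hq.ne']; positivity
  · have hy' : 0 < y := hL.trans (not_le.1 h)
    rw [sub_zero]
    calc y ^ q = y ^ m * y ^ (q - m) := by rw [← Real.rpow_add hy']; congr 1; ring
      _ ≤ _ := mul_le_mul_of_nonneg_left
        (Real.rpow_le_rpow_of_nonpos hL (not_le.1 h).le (by linarith)) (by positivity)

/-- Large moments of a truncated variable are controlled by moderate ones. -/
lemma truncAt_rpow_le {L y r m : ℝ} (hy : 0 ≤ y) (hL : 0 ≤ L) (hm : 0 < m) (hr : m ≤ r) :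
    truncAt L y ^ r ≤ L ^ (r - m) * y ^ m := by
  have h0 := truncAt_nonneg (L := L) hy
  calc truncAt L y ^ r = truncAt L y ^ (r - m) * truncAt L y ^ m := by
        rw [← Real.rpow_add_of_nonneg h0 (by linarith) hm.le]; congr 1; ring
    _ ≤ _ := by
        gcongr
        · exact truncAt_le_level hL
        · exact truncAt_le hy

/-- Second moments of a variable truncated at `V`, interpolated between moments of order `1` and
`m` with a free splitting level `L`. -/
lemma truncAt_sq_le {V L y m : ℝ} (hy : 0 ≤ y) (hV : 0 ≤ V) (hL : 0 < L) (hm : 0 < m) :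
    truncAt V y ^ 2 ≤ L * y + V ^ 2 * L ^ (-m) * y ^ m := by
  have h0 := truncAt_nonneg (L := V) hy
  have h1 := truncAt_le (L := V) hy
  rcases le_total y L with h | h
  · have : 0 ≤ V ^ 2 * L ^ (-m) * y ^ m := by positivity
    nlinarith
  · have h2 : 1 ≤ L ^ (-m) * y ^ m := by
      rw [Real.rpow_neg hL.le, inv_mul_eq_div, one_le_div (by positivity)]
      exact Real.rpow_le_rpow hL.le h hm.le
    have h3 : truncAt V y ^ 2 ≤ V ^ 2 := pow_le_pow_left₀ h0 (truncAt_le_level hV) 2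
    nlinarith [mul_le_mul_of_nonneg_left h2 (sq_nonneg V), mul_nonneg hL.le hy]

/-- High moments of centred sums of independent nonnegative variables truncated at the level `V`
of their total mean. Truncation makes moments of order `2 * p` available although the variables
have moments of order `p / 2` only. -/
lemma exists_integral_truncAt_sum_le {p : ℝ} (hp : 2 < p) :
    ∃ K : ℝ, 0 ≤ K ∧ ∀ {Ω : Type*} [MeasurableSpace Ω] {μ : Measure Ω} [IsProbabilityMeasure μ]
      {ι : Type*} [Fintype ι] {Y : ι → Ω → ℝ}, (∀ i, Measurable (Y i)) → iIndepFun Y μ →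
      (∀ i ω, 0 ≤ Y i ω) → (∀ i, Integrable (Y i) μ) →
      (∀ i, Integrable (fun ω => Y i ω ^ (p / 2)) μ) → ∀ {V A : ℝ}, 0 < V → 0 < A →
      ∑ i, ∫ ω, Y i ω ∂μ ≤ V → ∑ i, ∫ ω, Y i ω ^ (p / 2) ∂μ ≤ A → A ≤ V ^ (p / 2) →
      MemLp (fun ω => ∑ i, (truncAt V (Y i ω) - ∫ ω', truncAt V (Y i ω') ∂μ))
        (ENNReal.ofReal (2 * p)) μ ∧
      ∫ ω, |∑ i, (truncAt V (Y i ω) - ∫ ω', truncAt V (Y i ω') ∂μ)| ^ (2 * p) ∂μ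
        ≤ K * (A * V ^ (2 * p - p / 2)) := by
  obtain ⟨K, hK, hRos⟩ := exists_rosenthal (p := 2 * p) (by linarith)
  refine ⟨K * (2 ^ p + 2), by positivity,
    fun {Ω _ μ _ ι _ Y} hY hind hY0 hYi hYp V A hV hA hsV hsA hAV => ?_⟩
  have hp0 : 0 < p := by linarith
  set c : ι → ℝ := fun i => ∫ ω', truncAt V (Y i ω') ∂μ with hc
  have hWm : ∀ i, Measurable fun ω => truncAt V (Y i ω) := fun i =>
    (measurable_truncAt V).comp (hY i)
  have hW0 : ∀ i ω, 0 ≤ truncAt V (Y i ω) := fun i ω => truncAt_nonneg (hY0 i ω)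
  have hWb : ∀ i, MemLp (fun ω => truncAt V (Y i ω)) ⊤ μ := fun i =>
    memLp_top_of_bound (hWm i).aestronglyMeasurable V (ae_of_all μ fun ω => by
      rw [Real.norm_of_nonneg (hW0 i ω)]; exact truncAt_le_level hV.le)
  have hWi : ∀ i, Integrable (fun ω => truncAt V (Y i ω)) μ := fun i =>
    (hWb i).integrable le_top
  have hL : ∀ i, MemLp (fun ω => truncAt V (Y i ω) - c i) (ENNReal.ofReal (2 * p)) μ := fun i =>
    ((hWb i).mono_exponent le_top).sub (memLp_const _)
  have hc0 : ∀ i, 0 ≤ c i := fun i => integral_nonneg fun ω => hW0 i ω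
  have h := hRos (X := fun i ω => truncAt V (Y i ω) - c i) (fun i => (hWm i).sub_const _)
    (hind.comp (fun i y => truncAt V y - c i) fun i => (measurable_truncAt V).sub_const _) hL
    (fun i => by rw [integral_sub (hWi i) (integrable_const _)]; simp [hc]) Finset.univ
  simp only [Real.norm_eq_abs, sq_abs] at h
  refine ⟨memLp_finsetSum _ fun i _ => hL i, h.trans ?_⟩
  rw [mul_assoc]
  refine mul_le_mul_of_nonneg_left ?_ hK
  rw [add_mul]
  refine add_le_add ?_ ?_
  · -- variance term; the splitting level `L` interpolates between the moments of order `1`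
    -- and `p / 2`
    set B : ℝ := A / V ^ (p / 2) with hB
    have hB0 : 0 < B := by positivity
    have hB1 : B ≤ 1 := (div_le_one (by positivity)).2 hAV
    set L : ℝ := V * B ^ (1 / p) with hLdef
    have hL0 : 0 < L := by positivity
    have hvar : ∀ i, ∫ ω, (truncAt V (Y i ω) - c i) ^ 2 ∂μ
        ≤ L * ∫ ω, Y i ω ∂μ + V ^ 2 * L ^ (-(p / 2)) * ∫ ω, Y i ω ^ (p / 2) ∂μ := by
      intro i
      have h1 := variance_le_expectation_sq (μ := μ) (hWm i).aestronglyMeasurable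
      rw [variance_eq_integral (hWm i).aemeasurable] at h1
      refine h1.trans ?_
      rw [← integral_const_mul, ← integral_const_mul, ← integral_add ((hYi i).const_mul _)
        ((hYp i).const_mul _)]
      refine integral_mono ?_ (((hYi i).const_mul _).add ((hYp i).const_mul _)) fun ω =>
        truncAt_sq_le (hY0 i ω) hV.le hL0 (by positivity)
      exact ((hWb i).mono_exponent le_top : MemLp _ 2 μ).integrable_sq
    have hsum : ∑ i, ∫ ω, (truncAt V (Y i ω) - c i) ^ 2 ∂μ ≤ 2 * V ^ 2 * B ^ (1 / p) := by
      refine (Finset.sum_le_sum fun i _ => hvar i).trans ?_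
      rw [Finset.sum_add_distrib, ← Finset.mul_sum, ← Finset.mul_sum]
      have h2 : L * ∑ i, ∫ ω, Y i ω ∂μ ≤ V ^ 2 * B ^ (1 / p) := by
        refine (mul_le_mul_of_nonneg_left hsV hL0.le).trans (le_of_eq ?_)
        rw [hLdef]; ring
      have h3 : V ^ 2 * L ^ (-(p / 2)) * ∑ i, ∫ ω, Y i ω ^ (p / 2) ∂μ
          ≤ V ^ 2 * B ^ (1 / p) := by
        rw [mul_assoc]
        refine mul_le_mul_of_nonneg_left ?_ (sq_nonneg V)
        refine (mul_le_mul_of_nonneg_left hsA (by positivity)).trans ?_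
        have e : L ^ (-(p / 2)) * A = B ^ (1 / 2 : ℝ) := by
          have eA : A = B * V ^ (p / 2) := by rw [hB]; field_simp
          rw [eA, hLdef, Real.mul_rpow hV.le (by positivity), ← Real.rpow_mul hB0.le]
          have e2 : 1 / p * -(p / 2) = -(1 / 2) := by field_simp
          rw [e2, Real.rpow_neg hV.le]
          have e3 : B = B ^ (1 / 2 : ℝ) * B ^ (1 / 2 : ℝ) := by
            rw [← Real.rpow_add hB0]; norm_num
          have hV2 : V ^ (p / 2) ≠ 0 := by positivity
          have hBn : B ^ (1 / 2 : ℝ) ≠ 0 := by positivity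
          rw [Real.rpow_neg hB0.le]
          nth_rewrite 2 [e3]
          field_simp
        rw [e]
        refine Real.rpow_le_rpow_of_exponent_ge hB0 hB1 ?_
        exact one_div_le_one_div_of_le two_pos hp.le
      linarith
    calc _ ≤ (2 * V ^ 2 * B ^ (1 / p)) ^ (2 * p / 2) :=
          Real.rpow_le_rpow (Finset.sum_nonneg fun i _ => integral_nonneg fun ω => sq_nonneg _)
            hsum (by positivity)
      _ = _ := by
          rw [mul_div_cancel_left₀ _ two_ne_zero, Real.mul_rpow (by positivity) (by positivity),
            Real.mul_rpow (by positivity) (by positivity), ← Real.rpow_mul hB0.le,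
            one_div_mul_cancel hp0.ne', Real.rpow_one, ← Real.rpow_two, ← Real.rpow_mul hV.le,
            Real.rpow_sub hV, hB]
          ring
  · have hone : ∀ i, ∫ ω, |truncAt V (Y i ω) - c i| ^ (2 * p) ∂μ
        ≤ 2 * (V ^ (2 * p - p / 2) * ∫ ω, Y i ω ^ (p / 2) ∂μ) := by
      intro i
      have hWr : Integrable (fun ω => truncAt V (Y i ω) ^ (2 * p)) μ := by
        have := integrable_rpow_of_memLp (p := 2 * p) ((hWb i).mono_exponent le_top)
          (by positivity) le_rfl
        simpa only [Real.norm_of_nonneg (hW0 i _)] using this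
      have hWr1 : Integrable (fun ω => truncAt V (Y i ω) ^ (1 : ℝ)) μ := by
        simpa only [Real.rpow_one] using hWi i
      have hjen : c i ^ (2 * p) ≤ ∫ ω, truncAt V (Y i ω) ^ (2 * p) ∂μ := by
        have := integral_rpow_le_rpow (μ := μ) (hW0 i) one_pos (by linarith : 1 ≤ 2 * p) hWr1 hWr
        simp only [Real.rpow_one] at this
        have h2 := Real.rpow_le_rpow (hc0 i) this (by positivity : 0 ≤ 2 * p)
        rwa [← Real.rpow_mul (integral_nonneg fun ω => Real.rpow_nonneg (hW0 i ω) _),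
          one_div_mul_cancel (by positivity), Real.rpow_one] at h2
      have hpt : ∀ ω, |truncAt V (Y i ω) - c i| ^ (2 * p)
          ≤ truncAt V (Y i ω) ^ (2 * p) + c i ^ (2 * p) := by
        intro ω
        have h1 : 0 ≤ truncAt V (Y i ω) ^ (2 * p) := Real.rpow_nonneg (hW0 i ω) _
        have h2 : 0 ≤ c i ^ (2 * p) := Real.rpow_nonneg (hc0 i) _
        rcases abs_cases (truncAt V (Y i ω) - c i) with ⟨h, h'⟩ | ⟨h, h'⟩ <;> rw [h]
        · have := Real.rpow_le_rpow h' (by linarith [hc0 i] :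
            truncAt V (Y i ω) - c i ≤ truncAt V (Y i ω)) (by positivity : 0 ≤ 2 * p)
          linarith
        · have := Real.rpow_le_rpow (by linarith) (by linarith [hW0 i ω] :
            -(truncAt V (Y i ω) - c i) ≤ c i) (by positivity : 0 ≤ 2 * p)
          linarith
      have hmom : ∫ ω, truncAt V (Y i ω) ^ (2 * p) ∂μ
          ≤ V ^ (2 * p - p / 2) * ∫ ω, Y i ω ^ (p / 2) ∂μ := by
        rw [← integral_const_mul]
        exact integral_mono hWr ((hYp i).const_mul _) fun ω =>
          truncAt_rpow_le (hY0 i ω) hV.le (by positivity) (by linarith)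
      have hle : ∫ ω, |truncAt V (Y i ω) - c i| ^ (2 * p) ∂μ
          ≤ ∫ ω, (truncAt V (Y i ω) ^ (2 * p) + c i ^ (2 * p)) ∂μ :=
        integral_mono (integrable_rpow_of_memLp (hL i) (by positivity) le_rfl)
          (hWr.add (integrable_const _)) hpt
      rw [integral_add hWr (integrable_const _)] at hle
      simp only [integral_const, probReal_univ, one_smul] at hle
      linarith
    refine (Finset.sum_le_sum fun i _ => hone i).trans ?_
    rw [← Finset.mul_sum, ← Finset.mul_sum]
    have := mul_le_mul_of_nonneg_left hsA (by positivity : 0 ≤ V ^ (2 * p - p / 2))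
    linarith

/-! ### Deviation of squared norms of sums of independent vectors -/

lemma sum_rpow_le_sum_rpow_of_le_one {ι : Type*} (s : Finset ι) {f : ι → ℝ} (hf : ∀ i, 0 ≤ f i)
    {q : ℝ} (hq : 0 < q) (hq1 : q ≤ 1) : (∑ i ∈ s, f i) ^ q ≤ ∑ i ∈ s, f i ^ q := by
  classical
  induction s using Finset.induction_on with
  | empty => simp [Real.zero_rpow hq.ne']
  | insert i s hi ih =>
    rw [Finset.sum_insert hi, Finset.sum_insert hi]
    exact (Real.rpow_add_le_add_rpow (hf i) (Finset.sum_nonneg fun j _ => hf j) hq.le hq1).trans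
      (by linarith)

lemma max_rpow_le_of_le_add {x a b c d q : ℝ} (ha : 0 ≤ a) (hb : 0 ≤ b) (hc : 0 ≤ c) (hd : 0 < d)
    (h : x ≤ (a - d) + (b - d) + c) (hq : 0 < q) (hq1 : q ≤ 1) {m r : ℝ} (hm : q ≤ m)
    (hr : q ≤ r) :
    (max x 0) ^ q ≤ a ^ m * d ^ (q - m) + b ^ r * d ^ (q - r) + c ^ q := by
  have h1 := max_sub_rpow_le ha hd hq hm
  have h2 := max_sub_rpow_le hb hd hq hr
  have h3 : max x 0 ≤ max (a - d) 0 + max (b - d) 0 + c := by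
    have := le_max_left (a - d) 0
    have := le_max_left (b - d) 0
    have := le_max_right (a - d) 0
    have := le_max_right (b - d) 0
    exact max_le (by linarith) (by linarith)
  have h4 := Real.rpow_add_le_add_rpow (add_nonneg (le_max_right (a - d) 0)
    (le_max_right (b - d) 0)) hc hq.le hq1
  have h5 := Real.rpow_add_le_add_rpow (le_max_right (a - d) 0) (le_max_right (b - d) 0) hq.le hq1
  have h6 := Real.rpow_le_rpow (le_max_right x 0) h3 hq.le
  linarith

/-- Deviation of `‖∑ i, X i‖ ^ 2` above `1 + η` times the sum `V` of the variances, for independent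
centred vectors whose weak variance and strong moments of order `p` are both governed by `A`.
The bound is linear in `A`, so that it can be summed over a collection of models. -/
theorem exists_integral_sq_norm_sub_le {p q η : ℝ} (hp : 2 < p) (hq : 0 < q) (hq1 : q ≤ 1)
    (hη : 0 < η) :
    ∃ K : ℝ, 0 ≤ K ∧ ∀ {Ω : Type*} [MeasurableSpace Ω] {μ : Measure Ω} [IsProbabilityMeasure μ]
      {H : Type*} [NormedAddCommGroup H] [InnerProductSpace ℝ H] [CompleteSpace H]
      [MeasurableSpace H] [BorelSpace H] [SecondCountableTopology H]
      {ι : Type*} [Fintype ι] {X : ι → Ω → H}, (∀ i, Measurable (X i)) → iIndepFun X μ →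
      (∀ i, MemLp (X i) (ENNReal.ofReal p) μ) → (∀ i, ∫ ω, X i ω ∂μ = 0) →
      ∀ {A V : ℝ}, 0 < A → 0 < V → ∑ i, ∫ ω, ‖X i ω‖ ^ p ∂μ ≤ A →
      ∑ i, ∫ ω, ‖X i ω‖ ^ 2 ∂μ = V →
      (∀ x : H, ∑ i, ∫ ω, inner ℝ x (X i ω) ^ 2 ∂μ ≤ A ^ (2 / p) * ‖x‖ ^ 2) →
      Integrable (fun ω => (max (‖∑ i, X i ω‖ ^ 2 - (1 + η) * V) 0) ^ q) μ ∧
      ∫ ω, (max (‖∑ i, X i ω‖ ^ 2 - (1 + η) * V) 0) ^ q ∂μ ≤ K * (A * V ^ (q - p / 2)) := by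
  obtain ⟨R, hR, hRos⟩ := exists_rosenthal hp
  obtain ⟨K₁, hK₁, hOff⟩ := exists_integral_offDiag_le hp
  obtain ⟨K₂, hK₂, hDiag⟩ := exists_integral_truncAt_sum_le hp
  refine ⟨2 * R + ((η / 2) ^ (q - p) * (2 * K₁) + (η / 2) ^ (q - 2 * p) * K₂ + 1),
    by positivity,
    fun {Ω _ μ _ H _ _ _ _ _ _ ι _ X} hX hind hL h0 A V hA hV hsA hsV hw => ?_⟩
  have hp0 : 0 < p := by linarith
  have hS : MemLp (fun ω => ∑ i, X i ω) (ENNReal.ofReal p) μ :=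
    memLp_finsetSum _ fun j _ => hL j
  have hSi := integrable_rpow_of_memLp hS hp0.le le_rfl
  have hSm : Measurable fun ω => ∑ i, X i ω := Finset.measurable_fun_sum _ fun j _ => hX j
  have hm : Measurable fun ω => (max (‖∑ i, X i ω‖ ^ 2 - (1 + η) * V) 0) ^ q :=
    (((hSm.norm.pow_const 2).sub_const _).max measurable_const).pow_const q
  -- the crude bound by the strong moment of the sum
  have hcrude : ∀ ω, (max (‖∑ i, X i ω‖ ^ 2 - (1 + η) * V) 0) ^ q
      ≤ ‖∑ i, X i ω‖ ^ p * V ^ (q - p / 2) := by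
    intro ω
    have h1 := max_sub_rpow_le (sq_nonneg ‖∑ i, X i ω‖) hV hq (by linarith : q ≤ p / 2)
    rw [← Real.rpow_two, ← Real.rpow_mul (norm_nonneg _), mul_div_cancel₀ _ two_ne_zero,
      Real.rpow_two] at h1
    refine (Real.rpow_le_rpow (le_max_right _ _) (max_le_max ?_ le_rfl) hq.le).trans h1
    nlinarith
  have hint : Integrable (fun ω => (max (‖∑ i, X i ω‖ ^ 2 - (1 + η) * V) 0) ^ q) μ :=
    (hSi.mul_const _).mono' hm.aestronglyMeasurable (ae_of_all μ fun ω => by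
      rw [Real.norm_of_nonneg (Real.rpow_nonneg (le_max_right _ _) _)]; exact hcrude ω)
  refine ⟨hint, ?_⟩
  have hAV0 : 0 ≤ A * V ^ (q - p / 2) := by positivity
  rcases le_or_gt (V ^ (p / 2)) A with hc | hc
  · have h1 : ∫ ω, ‖∑ i, X i ω‖ ^ p ∂μ ≤ 2 * R * A := by
      have := hRos hX hind hL h0 Finset.univ
      rw [hsV] at this
      nlinarith [mul_le_mul_of_nonneg_left (add_le_add hc hsA) hR]
    calc _ ≤ ∫ ω, ‖∑ i, X i ω‖ ^ p * V ^ (q - p / 2) ∂μ :=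
          integral_mono hint (hSi.mul_const _) hcrude
      _ ≤ 2 * R * A * V ^ (q - p / 2) := by
          rw [integral_mul_const]; gcongr
      _ ≤ _ := by
          have : 0 ≤ ((η / 2) ^ (q - p) * (2 * K₁) + (η / 2) ^ (q - 2 * p) * K₂ + 1)
            * (A * V ^ (q - p / 2)) := by positivity
          linarith
  -- from here on `A < V ^ (p / 2)`
  have hYp : ∀ i ω, (‖X i ω‖ ^ 2) ^ (p / 2) = ‖X i ω‖ ^ p := fun i ω => by
    rw [← Real.rpow_two, ← Real.rpow_mul (norm_nonneg _), mul_div_cancel₀ _ two_ne_zero]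
  obtain ⟨hTL, hT⟩ := hDiag (Y := fun i ω => ‖X i ω‖ ^ 2) (fun i => (hX i).norm.pow_const 2)
    (hind.comp (fun _ x => ‖x‖ ^ 2) fun _ => measurable_norm.pow_const 2)
    (fun i ω => sq_nonneg _) (fun i => integrable_sq_of_memLp (hL i) hp.le)
    (fun i => by simpa only [hYp] using integrable_rpow_of_memLp (hL i) hp0.le le_rfl) hV hA
    hsV.le (by simpa only [hYp] using hsA) hc.le
  have hO := hOff hX hind hL h0 hsA hw
  have hOL := memLp_offDiag hX hind hp0 hL Finset.univ
  rw [hsV] at hO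
  set c : ι → ℝ := fun i => ∫ ω', truncAt V (‖X i ω'‖ ^ 2) ∂μ with hcdef
  have hcV : ∑ i, c i ≤ V := by
    rw [← hsV]
    refine Finset.sum_le_sum fun i _ => ?_
    refine integral_mono_of_nonneg (ae_of_all μ fun ω => truncAt_nonneg (sq_nonneg _))
      (integrable_sq_of_memLp (hL i) hp.le) (ae_of_all μ fun ω => ?_)
    exact truncAt_le (sq_nonneg _)
  have hd : 0 < η / 2 * V := by positivity
  set T : Ω → ℝ := fun ω => ∑ i, (truncAt V (‖X i ω‖ ^ 2) - c i) with hTdef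
  have hpt : ∀ ω, (max (‖∑ i, X i ω‖ ^ 2 - (1 + η) * V) 0) ^ q
      ≤ |offDiag X Finset.univ ω| ^ p * (η / 2 * V) ^ (q - p)
        + |T ω| ^ (2 * p) * (η / 2 * V) ^ (q - 2 * p)
        + (∑ i, ‖X i ω‖ ^ p) * V ^ (q - p / 2) := by
    intro ω
    have hrem : (∑ i, (‖X i ω‖ ^ 2 - truncAt V (‖X i ω‖ ^ 2))) ^ q
        ≤ (∑ i, ‖X i ω‖ ^ p) * V ^ (q - p / 2) := by
      refine (sum_rpow_le_sum_rpow_of_le_one _ (fun i => sub_nonneg.2 (truncAt_le (sq_nonneg _)))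
        hq hq1).trans ?_
      rw [Finset.sum_mul]
      refine Finset.sum_le_sum fun i _ => ?_
      rw [← hYp]
      exact sub_truncAt_rpow_le (sq_nonneg _) hV hq (by linarith)
    have hdec : ‖∑ i, X i ω‖ ^ 2 - (1 + η) * V ≤ (|offDiag X Finset.univ ω| - η / 2 * V)
        + (|T ω| - η / 2 * V) + ∑ i, (‖X i ω‖ ^ 2 - truncAt V (‖X i ω‖ ^ 2)) := by
      have h1 := le_abs_self (offDiag X Finset.univ ω)
      have h2 := le_abs_self (T ω)
      have h3 : T ω = ∑ i, truncAt V (‖X i ω‖ ^ 2) - ∑ i, c i := by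
        rw [hTdef]; simp only [Finset.sum_sub_distrib]
      have h4 : offDiag X Finset.univ ω = ‖∑ i, X i ω‖ ^ 2 - ∑ i, ‖X i ω‖ ^ 2 := rfl
      rw [Finset.sum_sub_distrib]
      linarith
    have := max_rpow_le_of_le_add (abs_nonneg _) (abs_nonneg _) (Finset.sum_nonneg fun i _ =>
      sub_nonneg.2 (truncAt_le (sq_nonneg _))) hd hdec hq hq1 (by linarith : q ≤ p)
      (by linarith : q ≤ 2 * p)
    linarith
  have iO : Integrable (fun ω => |offDiag X Finset.univ ω| ^ p) μ :=
    integrable_rpow_of_memLp hOL hp0.le le_rfl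
  have iT : Integrable (fun ω => |T ω| ^ (2 * p)) μ :=
    integrable_rpow_of_memLp hTL (by positivity) le_rfl
  have iX : Integrable (fun ω => ∑ i, ‖X i ω‖ ^ p) μ :=
    integrable_finsetSum _ fun i _ => integrable_rpow_of_memLp (hL i) hp0.le le_rfl
  have hmain := integral_mono hint (((iO.mul_const _).add (iT.mul_const _)).add
    (iX.mul_const _)) hpt
  simp only [Pi.add_apply] at hmain
  rw [integral_add ((iO.mul_const _).fun_add (iT.mul_const _)) (iX.mul_const _),
    integral_add (iO.mul_const _) (iT.mul_const _), integral_mul_const, integral_mul_const,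
    integral_mul_const, integral_finsetSum _ fun i _ =>
      integrable_rpow_of_memLp (hL i) hp0.le le_rfl] at hmain
  have e1 : (∫ ω, |offDiag X Finset.univ ω| ^ p ∂μ) * (η / 2 * V) ^ (q - p)
      ≤ (η / 2) ^ (q - p) * (2 * K₁) * (A * V ^ (q - p / 2)) := by
    have h1 : A * V ^ (p / 2) + A ^ 2 ≤ 2 * (A * V ^ (p / 2)) := by nlinarith
    calc _ ≤ K₁ * (2 * (A * V ^ (p / 2))) * (η / 2 * V) ^ (q - p) := by
          gcongr
          exact hO.trans (mul_le_mul_of_nonneg_left h1 hK₁)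
      _ = _ := by
          rw [Real.mul_rpow (by positivity) hV.le,
            show V ^ (q - p / 2) = V ^ (p / 2) * V ^ (q - p) by
              rw [← Real.rpow_add hV]; congr 1; ring]
          ring
  have e2 : (∫ ω, |T ω| ^ (2 * p) ∂μ) * (η / 2 * V) ^ (q - 2 * p)
      ≤ (η / 2) ^ (q - 2 * p) * K₂ * (A * V ^ (q - p / 2)) := by
    calc _ ≤ K₂ * (A * V ^ (2 * p - p / 2)) * (η / 2 * V) ^ (q - 2 * p) := by gcongr
      _ = _ := by
          rw [Real.mul_rpow (by positivity) hV.le,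
            show V ^ (q - p / 2) = V ^ (2 * p - p / 2) * V ^ (q - 2 * p) by
              rw [← Real.rpow_add hV]; congr 1; ring]
          ring
  have e3 : (∑ i, ∫ ω, ‖X i ω‖ ^ p ∂μ) * V ^ (q - p / 2) ≤ A * V ^ (q - p / 2) := by gcongr
  have e4 : 0 ≤ 2 * R * (A * V ^ (q - p / 2)) := by positivity
  linarith

/-! ### Blocks and projections of stacked vectors -/

namespace VecReg

section Geometry

variable {n d : ℕ}

/-- The `i`-th block of a stacked vector. -/
noncomputable def block (i : Fin n) : Stacked n d →L[ℝ] EuclideanSpace ℝ (Fin d) :=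
  LinearMap.toContinuousLinearMap
    { toFun := fun w => WithLp.toLp 2 fun a => w (i, a)
      map_add' := fun _ _ => rfl
      map_smul' := fun _ _ => rfl }

/-- The embedding of `ℝ^d` into `ℝ^{nd}` as the `i`-th block. -/
noncomputable def blockIncl (i : Fin n) : EuclideanSpace ℝ (Fin d) →L[ℝ] Stacked n d :=
  LinearMap.toContinuousLinearMap
    { toFun := fun v => WithLp.toLp 2 fun ja => if ja.1 = i then v ja.2 else 0
      map_add' := fun v w => by ext ja; simp only [PiLp.add_apply]; split_ifs <;> simp
      map_smul' := fun c v => by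
        ext ja; simp only [PiLp.smul_apply, RingHom.id_apply]; split_ifs <;> simp }

lemma block_apply (i : Fin n) (w : Stacked n d) (a : Fin d) : block i w a = w (i, a) := rfl

lemma blockIncl_apply (i : Fin n) (v : EuclideanSpace ℝ (Fin d)) (ja : Fin n × Fin d) :
    blockIncl i v ja = if ja.1 = i then v ja.2 else 0 := rfl

lemma inner_blockIncl (i : Fin n) (v : EuclideanSpace ℝ (Fin d)) (w : Stacked n d) :
    inner ℝ w (blockIncl i v) = inner ℝ (block i w) v := by
  simp only [PiLp.inner_apply, Fintype.sum_prod_type, blockIncl_apply, block_apply]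
  rw [Finset.sum_eq_single i (fun j _ hj => by simp [hj]) (by simp)]
  simp

lemma sum_norm_sq_block (w : Stacked n d) : ∑ i, ‖block i w‖ ^ 2 = ‖w‖ ^ 2 := by
  simp only [EuclideanSpace.norm_sq_eq, Fintype.sum_prod_type, block_apply]

lemma sum_blockIncl (v : Fin n → EuclideanSpace ℝ (Fin d)) :
    ∑ i, blockIncl i (v i) = stack v := by
  ext ja
  simp [stack, WithLp.ofLp_sum, Finset.sum_apply, blockIncl_apply]

lemma block_stack (v : Fin n → EuclideanSpace ℝ (Fin d)) (i : Fin n) :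
    block i (stack v) = v i := rfl

lemma stack_add (v w : Fin n → EuclideanSpace ℝ (Fin d)) :
    stack (fun i => v i + w i) = stack v + stack w := rfl

lemma blockIncl_eq_sum (i : Fin n) (v : EuclideanSpace ℝ (Fin d)) :
    blockIncl i v = ∑ a, v a • EuclideanSpace.single (i, a) (1 : ℝ) := by
  ext ⟨j, b⟩
  simp only [blockIncl_apply, WithLp.ofLp_sum, Finset.sum_apply, PiLp.smul_apply,
    PiLp.single_apply, Prod.mk.injEq, smul_eq_mul, mul_ite, mul_one, mul_zero]
  split_ifs with h
  · simp [h]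
  · simp [h]

variable (S : Submodule ℝ (Stacked n d))

lemma inner_proj_left (x y : Stacked n d) :
    inner ℝ (proj S x) y = inner ℝ x (proj S y) :=
  S.starProjection_isSymmetric x y

lemma proj_proj (x : Stacked n d) : proj S (proj S x) = proj S x :=
  S.starProjection_eq_self_iff.2 (S.starProjection_apply_mem x)

lemma norm_proj_le (x : Stacked n d) : ‖proj S x‖ ≤ ‖x‖ := S.norm_starProjection_apply_le x

lemma norm_sq_proj (x : Stacked n d) : ‖proj S x‖ ^ 2 = inner ℝ x (proj S x) := by
  rw [← real_inner_self_eq_norm_sq, inner_proj_left, proj_proj]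

/-- Pythagoras for a vector of the model and a vector orthogonal to it. -/
lemma norm_sq_sub_proj_add (x z : Stacked n d) :
    ‖x - proj S x + proj S z‖ ^ 2 = ‖x - proj S x‖ ^ 2 + ‖proj S z‖ ^ 2 := by
  have : inner ℝ (x - proj S x) (proj S z) = 0 := by
    rw [← inner_proj_left, map_sub, proj_proj, sub_self, inner_zero_left]
  rw [norm_add_sq_real, this]; ring

lemma norm_sq_sub_proj_le (x : Stacked n d) : ‖x - proj S x‖ ^ 2 ≤ ‖x‖ ^ 2 := by
  have := norm_sq_sub_proj_add S x x
  rw [sub_add_cancel] at this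
  nlinarith [sq_nonneg ‖proj S x‖]

lemma projMatrix_apply (k l : Fin n × Fin d) :
    projMatrix S k l = proj S (EuclideanSpace.single l 1) k := by
  rw [projMatrix, LinearMap.toMatrix_apply]
  simp

/-- The trace `∑ₐ ‖P e_{(i, a)}‖²` of the `i`-th diagonal block of the projection. -/
noncomputable def blockTrace (i : Fin n) : ℝ :=
  ∑ a : Fin d, ‖proj S (EuclideanSpace.single (i, a) 1)‖ ^ 2

lemma sum_blockTrace : ∑ i, blockTrace S i = modelDim S := by
  have h1 : LinearMap.trace ℝ _ (proj S : Stacked n d →ₗ[ℝ] Stacked n d) = modelDim S :=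
    LinearMap.IsProj.trace (p := S) ⟨fun x => S.starProjection_apply_mem x,
      fun x hx => S.starProjection_eq_self_iff.2 hx⟩
  rw [← h1, LinearMap.trace_eq_sum_inner _ (EuclideanSpace.basisFun (Fin n × Fin d) ℝ),
    Fintype.sum_prod_type]
  refine Finset.sum_congr rfl fun i _ => Finset.sum_congr rfl fun a _ => ?_
  rw [norm_sq_proj]
  simp

lemma norm_sq_proj_blockIncl_le (i : Fin n) (v : EuclideanSpace ℝ (Fin d)) :
    ‖proj S (blockIncl i v)‖ ^ 2 ≤ blockTrace S i * ‖v‖ ^ 2 := by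
  have h1 : ‖proj S (blockIncl i v)‖
      ≤ ∑ a, ‖proj S (EuclideanSpace.single (i, a) 1)‖ * ‖v a‖ := by
    rw [blockIncl_eq_sum, map_sum]
    refine (norm_sum_le _ _).trans (Finset.sum_le_sum fun a _ => ?_)
    rw [map_smul, norm_smul, mul_comm]
  calc _ ≤ (∑ a, ‖proj S (EuclideanSpace.single (i, a) 1)‖ * ‖v a‖) ^ 2 :=
        pow_le_pow_left₀ (norm_nonneg _) h1 2
    _ ≤ _ := by
        rw [EuclideanSpace.norm_sq_eq]
        exact Finset.sum_mul_sq_le_sq_mul_sq _ _ _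

lemma norm_blockIncl (i : Fin n) (v : EuclideanSpace ℝ (Fin d)) : ‖blockIncl i v‖ = ‖v‖ := by
  have : ‖blockIncl i v‖ ^ 2 = ‖v‖ ^ 2 := by
    rw [← real_inner_self_eq_norm_sq, inner_blockIncl, ← real_inner_self_eq_norm_sq]
    congr 1
    ext a
    simp [block_apply, blockIncl_apply]
  exact (pow_left_inj₀ (norm_nonneg _) (norm_nonneg _) two_ne_zero).1 this

/-- Since the trace of the block bounds `‖P v‖² / ‖v‖²`, which is at most `1`, it enters only to the
first power, whatever the order `κ` of the moment; summing over `i` then gives the dimension. -/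
lemma norm_proj_blockIncl_rpow_le {κ : ℝ} (hκ : 2 ≤ κ) (i : Fin n)
    (v : EuclideanSpace ℝ (Fin d)) :
    ‖proj S (blockIncl i v)‖ ^ κ ≤ blockTrace S i * ‖v‖ ^ κ := by
  have h1 : ‖proj S (blockIncl i v)‖ ≤ ‖v‖ := (norm_proj_le S _).trans (norm_blockIncl i v).le
  rcases (norm_nonneg v).eq_or_lt with h0 | h0
  · have h2 : ‖proj S (blockIncl i v)‖ = 0 := le_antisymm (h1.trans h0.symm.le) (norm_nonneg _)
    rw [h2, ← h0, Real.zero_rpow (by linarith), mul_zero]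
  have e : ∀ y : ℝ, 0 ≤ y → y ^ κ = y ^ (κ - 2) * y ^ 2 := fun y hy => by
    rw [← Real.rpow_two, ← Real.rpow_add_of_nonneg hy (by linarith) (by norm_num)]
    congr 1; ring
  rw [e _ (norm_nonneg _), e _ (norm_nonneg _)]
  calc _ ≤ ‖v‖ ^ (κ - 2) * (blockTrace S i * ‖v‖ ^ 2) := by
        gcongr ?_ * ?_
        · exact Real.rpow_le_rpow (norm_nonneg _) h1 (by linarith)
        · exact norm_sq_proj_blockIncl_le S i v
    _ = _ := by ring

lemma norm_sq_proj_blockIncl (i : Fin n) (v : EuclideanSpace ℝ (Fin d)) :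
    ‖proj S (blockIncl i v)‖ ^ 2 = ∑ a, ∑ b, projMatrix S (i, a) (i, b) * (v b * v a) := by
  rw [norm_sq_proj, real_inner_comm, inner_blockIncl, PiLp.inner_apply]
  refine Finset.sum_congr rfl fun a _ => ?_
  rw [block_apply, blockIncl_eq_sum, map_sum, WithLp.ofLp_sum, Finset.sum_apply]
  simp only [projMatrix_apply, map_smul, PiLp.smul_apply, smul_eq_mul, RCLike.inner_apply,
    conj_trivial, Finset.mul_sum]
  exact Finset.sum_congr rfl fun b _ => by ring

lemma deltaSq_mul_modelDim (Φ : Matrix (Fin d) (Fin d) ℝ) (hD : 0 < modelDim S) :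
    deltaSq Φ S * modelDim S = ∑ i, ∑ a, ∑ b, projMatrix S (i, a) (i, b) * Φ b a := by
  have : (modelDim S : ℝ) ≠ 0 := by positivity
  rw [deltaSq, div_mul_cancel₀ _ this, Matrix.trace, Fintype.sum_prod_type]
  refine Finset.sum_congr rfl fun i _ => Finset.sum_congr rfl fun a _ => ?_
  rw [Matrix.diag_apply, Matrix.mul_apply, Fintype.sum_prod_type,
    Finset.sum_eq_single i (fun j _ hj => ?_) (by simp)]
  · simp
  · simp [hj]

end Geometry

/-- Independent centred errors with covariance matrix `Φ` and common moment `E` of order `κ`. -/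
structure IsNoise {Ω : Type*} [MeasurableSpace Ω] (μ : Measure Ω) {n d : ℕ}
    (ε : Fin n → Ω → EuclideanSpace ℝ (Fin d)) (κ E : ℝ) (Φ : Matrix (Fin d) (Fin d) ℝ) :
    Prop where
  measurable : ∀ i, Measurable (ε i)
  indep : iIndepFun ε μ
  memLp : ∀ i, MemLp (ε i) (ENNReal.ofReal κ) μ
  mean : ∀ i, ∫ ω, ε i ω ∂μ = 0
  moment : ∀ i, ∫ ω, ‖ε i ω‖ ^ κ ∂μ = E
  cov : ∀ i a b, ∫ ω, ε i ω a * ε i ω b ∂μ = Φ a b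

section Noise

variable {Ω : Type*} [MeasurableSpace Ω] {μ : Measure Ω} [IsProbabilityMeasure μ] {n d : ℕ}
  {ε : Fin n → Ω → EuclideanSpace ℝ (Fin d)} {κ E : ℝ} {Φ : Matrix (Fin d) (Fin d) ℝ}

lemma isNoise_of_identDistrib (hκ : 2 ≤ κ) (i₀ : Fin n) (hm : ∀ i, Measurable (ε i))
    (hind : iIndepFun ε μ) (hid : ∀ i, IdentDistrib (ε i) (ε i₀) μ μ)
    (hint : Integrable (fun ω => ‖ε i₀ ω‖ ^ κ) μ) (hmean : ∫ ω, ε i₀ ω ∂μ = 0) :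
    IsNoise μ ε κ (∫ ω, ‖ε i₀ ω‖ ^ κ ∂μ) (covMatrix μ (ε i₀)) := by
  have hm0 : MemLp (ε i₀) (ENNReal.ofReal κ) μ :=
    memLp_ofReal_of_integrable (hm i₀).aestronglyMeasurable (by linarith) hint
  have hκ1 : (1 : ENNReal) ≤ ENNReal.ofReal κ := by
    rw [ENNReal.one_le_ofReal]; linarith
  have hcoord : ∀ a, ∫ ω, ε i₀ ω a ∂μ = 0 := fun a => by
    have := (EuclideanSpace.proj (𝕜 := ℝ) a : EuclideanSpace ℝ (Fin d) →L[ℝ] ℝ).integral_comp_comm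
      (hm0.integrable hκ1)
    simpa [hmean] using this
  refine ⟨hm, hind, fun i => (hid i).memLp_iff.2 hm0, fun i => (hid i).integral_eq.trans hmean,
    fun i => ?_, fun i a b => ?_⟩
  · exact ((hid i).comp (u := fun x => ‖x‖ ^ κ) (measurable_norm.pow_const κ)).integral_eq
  · have hu : Measurable fun x : EuclideanSpace ℝ (Fin d) => x a * x b := by fun_prop
    refine ((hid i).comp hu).integral_eq.trans ?_
    simp [covMatrix, covariance, hcoord]

end Noise

/-! ### Deviation of the projected noise -/

section Noise

variable {Ω : Type*} [MeasurableSpace Ω] {μ : Measure Ω} [IsProbabilityMeasure μ] {n d : ℕ}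
  {ε : Fin n → Ω → EuclideanSpace ℝ (Fin d)} {κ E : ℝ} {Φ : Matrix (Fin d) (Fin d) ℝ}

namespace IsNoise

lemma moment_nonneg {μ : Measure Ω} (h : IsNoise μ ε κ E Φ) (i : Fin n) : 0 ≤ E :=
  h.moment i ▸ integral_nonneg fun ω => by positivity

lemma integral_norm_sq_le (h : IsNoise μ ε κ E Φ) (hκ : 2 ≤ κ) (i : Fin n) :
    ∫ ω, ‖ε i ω‖ ^ 2 ∂μ ≤ E ^ (2 / κ) := by
  have := integral_rpow_le_rpow (μ := μ) (f := fun ω => ‖ε i ω‖) (fun ω => norm_nonneg _) two_pos hκ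
    (integrable_rpow_of_memLp (h.memLp i) zero_le_two hκ)
    (integrable_rpow_of_memLp (h.memLp i) (by linarith) le_rfl)
  simpa only [Real.rpow_two, h.moment i] using this

lemma integral_inner_sq_le (h : IsNoise μ ε κ E Φ) (hκ : 2 ≤ κ) (i : Fin n)
    (x : EuclideanSpace ℝ (Fin d)) :
    ∫ ω, inner ℝ x (ε i ω) ^ 2 ∂μ ≤ ‖x‖ ^ 2 * E ^ (2 / κ) := by
  have h2 := integrable_sq_of_memLp (h.memLp i) hκ
  calc ∫ ω, inner ℝ x (ε i ω) ^ 2 ∂μ ≤ ∫ ω, ‖x‖ ^ 2 * ‖ε i ω‖ ^ 2 ∂μ := by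
        refine integral_mono_of_nonneg (ae_of_all μ fun ω => sq_nonneg _) (h2.const_mul _)
          (ae_of_all μ fun ω => ?_)
        change inner ℝ x (ε i ω) ^ 2 ≤ ‖x‖ ^ 2 * ‖ε i ω‖ ^ 2
        rw [← mul_pow, ← sq_abs]
        exact pow_le_pow_left₀ (abs_nonneg _) (abs_real_inner_le_norm _ _) 2
    _ ≤ _ := by
        rw [integral_const_mul]
        exact mul_le_mul_of_nonneg_left (h.integral_norm_sq_le hκ i) (sq_nonneg _)

lemma memLp_stack {μ : Measure Ω} (h : IsNoise μ ε κ E Φ) :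
    MemLp (fun ω => stack fun i => ε i ω) (ENNReal.ofReal κ) μ := by
  simp only [← sum_blockIncl]
  exact memLp_finsetSum _ fun i _ => (blockIncl i).comp_memLp' (h.memLp i)

lemma measurable_stack {μ : Measure Ω} (h : IsNoise μ ε κ E Φ) :
    Measurable fun ω => stack fun i => ε i ω := by
  simp only [← sum_blockIncl]
  exact Finset.measurable_fun_sum _ fun i _ => (blockIncl i).measurable.comp (h.measurable i)

lemma integral_norm_stack_rpow_le (h : IsNoise μ ε κ E Φ) (hκ : 2 ≤ κ) (hn : 0 < n) :
    ∫ ω, ‖stack fun i => ε i ω‖ ^ κ ∂μ ≤ (n : ℝ) ^ (κ / 2) * E := by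
  have hn' : (0 : ℝ) < n := by exact_mod_cast hn
  have e : ∀ y : ℝ, 0 ≤ y → y ^ κ = (y ^ 2) ^ (κ / 2) := fun y hy => by
    rw [← Real.rpow_two, ← Real.rpow_mul hy, mul_div_cancel₀ _ two_ne_zero]
  have hi : ∀ i, Integrable (fun ω => ‖ε i ω‖ ^ κ) μ := fun i =>
    integrable_rpow_of_memLp (h.memLp i) (by linarith) le_rfl
  have hpt : ∀ ω, ‖stack fun i => ε i ω‖ ^ κ ≤ (n : ℝ) ^ (κ / 2 - 1) * ∑ i, ‖ε i ω‖ ^ κ := by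
    intro ω
    rw [e _ (norm_nonneg _), ← sum_norm_sq_block]
    simp only [block_stack]
    refine (Real.rpow_sum_le_const_mul_sum_rpow_of_nonneg Finset.univ (by linarith)
      fun i _ => sq_nonneg _).trans (le_of_eq ?_)
    rw [Finset.card_univ, Fintype.card_fin]
    congr 1
    exact Finset.sum_congr rfl fun i _ => (e _ (norm_nonneg _)).symm
  calc _ ≤ ∫ ω, (n : ℝ) ^ (κ / 2 - 1) * ∑ i, ‖ε i ω‖ ^ κ ∂μ :=
        integral_mono (integrable_rpow_of_memLp h.memLp_stack (by linarith) le_rfl)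
          ((integrable_finsetSum _ fun i _ => hi i).const_mul _) hpt
    _ = _ := by
        rw [integral_const_mul, integral_finsetSum _ fun i _ => hi i]
        simp only [h.moment]
        rw [Finset.sum_const, Finset.card_univ, Fintype.card_fin, nsmul_eq_mul, ← mul_assoc,
          ← Real.rpow_add_one hn'.ne', sub_add_cancel]

/-- The mean of `‖P ε‖²` is `Tr (P (Iₙ ⊗ Φ)) = δ² D`, written blockwise. -/
lemma sum_integral_norm_sq_proj (h : IsNoise μ ε κ E Φ) (hκ : 2 ≤ κ)
    (S : Submodule ℝ (Stacked n d)) (hD : 0 < modelDim S) :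
    ∑ i, ∫ ω, ‖proj S (blockIncl i (ε i ω))‖ ^ 2 ∂μ = deltaSq Φ S * modelDim S := by
  rw [deltaSq_mul_modelDim S Φ hD]
  refine Finset.sum_congr rfl fun i _ => ?_
  have hab : ∀ a b, Integrable (fun ω => ε i ω b * ε i ω a) μ := fun a b => by
    have h2 : MemLp (ε i) 2 μ := by
      have := (h.memLp i).mono_exponent (ENNReal.ofReal_le_ofReal hκ)
      simpa using this
    have hc : ∀ a, MemLp (fun ω => ε i ω a) 2 μ := fun a =>
      (EuclideanSpace.proj (𝕜 := ℝ) a : EuclideanSpace ℝ (Fin d) →L[ℝ] ℝ).comp_memLp' h2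
    exact (hc b).integrable_mul (hc a)
  simp only [norm_sq_proj_blockIncl]
  rw [integral_finsetSum _ fun a _ => integrable_finsetSum _ fun b _ => (hab a b).const_mul _]
  refine Finset.sum_congr rfl fun a _ => ?_
  rw [integral_finsetSum _ fun b _ => (hab a b).const_mul _]
  refine Finset.sum_congr rfl fun b _ => ?_
  rw [integral_const_mul, h.cov]

end IsNoise

end Noise

/-- Deviation of the noise projected on a model above its mean `δ² D`. The summands are
`P εᵢ`; their strong moments sum up to at most `D E` and their weak variance is at most
`E ^ (2 / κ)`. -/
theorem exists_integral_norm_sq_proj_sub_le {κ q η : ℝ} (hκ : 2 < κ) (hq : 0 < q) (hq1 : q ≤ 1)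
    (hη : 0 < η) :
    ∃ K : ℝ, 0 ≤ K ∧ ∀ {Ω : Type*} [MeasurableSpace Ω] {μ : Measure Ω} [IsProbabilityMeasure μ]
      {n d : ℕ} {ε : Fin n → Ω → EuclideanSpace ℝ (Fin d)} {E : ℝ}
      {Φ : Matrix (Fin d) (Fin d) ℝ}, 0 < n → IsNoise μ ε κ E Φ →
      ∀ S : Submodule ℝ (Stacked n d), 0 < modelDim S → 0 < deltaSq Φ S →
      Integrable (fun ω => (max (‖proj S (stack fun i => ε i ω)‖ ^ 2
        - (1 + η) * (deltaSq Φ S * modelDim S)) 0) ^ q) μ ∧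
      ∫ ω, (max (‖proj S (stack fun i => ε i ω)‖ ^ 2
        - (1 + η) * (deltaSq Φ S * modelDim S)) 0) ^ q ∂μ
        ≤ K * (modelDim S * E * (deltaSq Φ S * modelDim S) ^ (q - κ / 2)) := by
  obtain ⟨K, hK, hdev⟩ := exists_integral_sq_norm_sub_le hκ hq hq1 hη
  refine ⟨K, hK, fun {Ω _ μ _ n d ε E Φ} hn h S hD hδ => ?_⟩
  have hκ0 : 0 < κ := by linarith
  have hD' : (1 : ℝ) ≤ modelDim S := by exact_mod_cast hD
  have hV : 0 < deltaSq Φ S * modelDim S := by positivity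
  have hE0 : 0 ≤ E := h.moment_nonneg ⟨0, hn⟩
  have hXm : ∀ i, Measurable fun ω => proj S (blockIncl i (ε i ω)) := fun i =>
    ((proj S).comp (blockIncl i)).measurable.comp (h.measurable i)
  have hXL : ∀ i, MemLp (fun ω => proj S (blockIncl i (ε i ω))) (ENNReal.ofReal κ) μ := fun i =>
    ((proj S).comp (blockIncl i)).comp_memLp' (h.memLp i)
  have hκ1 : (1 : ENNReal) ≤ ENNReal.ofReal κ := by
    rw [ENNReal.one_le_ofReal]; linarith
  have hsV := h.sum_integral_norm_sq_proj hκ.le S hD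
  -- a model of positive variance forces a positive moment
  have hE : 0 < E := by
    refine hE0.lt_of_ne fun h0 => hV.ne' ?_
    rw [← hsV]
    refine Finset.sum_eq_zero fun i _ => le_antisymm ?_ (integral_nonneg fun ω => sq_nonneg _)
    have h1 := h.integral_norm_sq_le hκ.le i
    rw [← h0, Real.zero_rpow (by positivity)] at h1
    refine le_trans (integral_mono (integrable_sq_of_memLp (hXL i) hκ.le)
      (integrable_sq_of_memLp (h.memLp i) hκ.le) fun ω => ?_) h1
    exact pow_le_pow_left₀ (norm_nonneg _)
      ((norm_proj_le S _).trans (norm_blockIncl i _).le) 2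
  have hsA : ∑ i, ∫ ω, ‖proj S (blockIncl i (ε i ω))‖ ^ κ ∂μ ≤ modelDim S * E := by
    rw [← sum_blockTrace, Finset.sum_mul]
    refine Finset.sum_le_sum fun i _ => ?_
    rw [← h.moment i, ← integral_const_mul]
    exact integral_mono (integrable_rpow_of_memLp (hXL i) hκ0.le le_rfl)
      ((integrable_rpow_of_memLp (h.memLp i) hκ0.le le_rfl).const_mul _)
      fun ω => norm_proj_blockIncl_rpow_le S hκ.le i _
  have hw : ∀ x : Stacked n d, ∑ i, ∫ ω, inner ℝ x (proj S (blockIncl i (ε i ω))) ^ 2 ∂μ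
      ≤ (modelDim S * E) ^ (2 / κ) * ‖x‖ ^ 2 := by
    intro x
    simp only [← inner_proj_left S x, inner_blockIncl]
    refine (Finset.sum_le_sum fun i _ => h.integral_inner_sq_le hκ.le i _).trans ?_
    rw [← Finset.sum_mul, sum_norm_sq_block, mul_comm]
    gcongr
    · nlinarith
    · exact norm_proj_le S x
  have := hdev hXm (h.indep.comp (fun i v => proj S (blockIncl i v)) fun i =>
    ((proj S).comp (blockIncl i)).measurable) hXL
    (fun i => by
      have := ((proj S).comp (blockIncl i)).integral_comp_comm ((h.memLp i).integrable hκ1)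
      simpa [h.mean i] using this)
    (by positivity : 0 < modelDim S * E) hV hsA hsV hw
  simpa only [← map_sum, sum_blockIncl] using this

/-- Deviation of a linear functional of the noise above an arbitrary level `V`. The moment of
order `κ` of the functional is at most a constant times `E`, whatever `n` and `d`. -/
theorem exists_integral_inner_sq_sub_le {κ q : ℝ} (hκ : 2 < κ) (hq : 0 < q) (hq1 : q ≤ 1) :
    ∃ K : ℝ, 0 ≤ K ∧ ∀ {Ω : Type*} [MeasurableSpace Ω] {μ : Measure Ω} [IsProbabilityMeasure μ]
      {n d : ℕ} {ε : Fin n → Ω → EuclideanSpace ℝ (Fin d)} {E : ℝ}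
      {Φ : Matrix (Fin d) (Fin d) ℝ}, 0 < n → IsNoise μ ε κ E Φ →
      ∀ u : Stacked n d, ‖u‖ ≤ 1 → ∀ {V : ℝ}, 0 < V →
      Integrable (fun ω => (max (inner ℝ u (stack fun i => ε i ω) ^ 2 - V) 0) ^ q) μ ∧
      ∫ ω, (max (inner ℝ u (stack fun i => ε i ω) ^ 2 - V) 0) ^ q ∂μ
        ≤ K * (E * V ^ (q - κ / 2)) := by
  obtain ⟨K, hK, hRos⟩ := exists_rosenthal hκ
  refine ⟨2 * K, by positivity, fun {Ω _ μ _ n d ε E Φ} hn h u hu V hV => ?_⟩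
  have hκ0 : 0 < κ := by linarith
  have hE0 : 0 ≤ E := h.moment_nonneg ⟨0, hn⟩
  have hκ1 : (1 : ENNReal) ≤ ENNReal.ofReal κ := by
    rw [ENNReal.one_le_ofReal]; linarith
  have hu2 : ∑ i, ‖block i u‖ ^ 2 ≤ 1 := by
    rw [sum_norm_sq_block]; exact pow_le_one₀ (norm_nonneg _) hu
  have hb1 : ∀ i, ‖block i u‖ ≤ 1 := fun i => by
    have := (Finset.single_le_sum (f := fun i => ‖block i u‖ ^ 2) (fun i _ => sq_nonneg _)
      (Finset.mem_univ i)).trans hu2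
    exact (sq_le_one_iff₀ (norm_nonneg _)).1 this
  have hsum : ∀ ω, inner ℝ u (stack fun i => ε i ω) = ∑ i, inner ℝ (block i u) (ε i ω) :=
    fun ω => by rw [← sum_blockIncl, inner_sum]; simp only [inner_blockIncl]
  have hXL : ∀ i, MemLp (fun ω => inner ℝ (block i u) (ε i ω)) (ENNReal.ofReal κ) μ := fun i =>
    (h.memLp i).const_inner _
  have hR := hRos (X := fun i ω => inner ℝ (block i u) (ε i ω))
    (fun i => measurable_const.inner (h.measurable i))
    (h.indep.comp (fun i v => inner ℝ (block i u) v) fun i =>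
      measurable_const.inner measurable_id) hXL
    (fun i => by
      rw [integral_inner ((h.memLp i).integrable hκ1), h.mean i, inner_zero_right]) Finset.univ
  simp only [← hsum] at hR
  have h2 : (∑ i, ∫ ω, ‖inner ℝ (block i u) (ε i ω)‖ ^ 2 ∂μ) ^ (κ / 2) ≤ E := by
    have h3 : ∑ i, ∫ ω, ‖inner ℝ (block i u) (ε i ω)‖ ^ 2 ∂μ ≤ E ^ (2 / κ) := by
      simp only [Real.norm_eq_abs, sq_abs]
      refine (Finset.sum_le_sum fun i _ => h.integral_inner_sq_le hκ.le i _).trans ?_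
      rw [← Finset.sum_mul]
      exact mul_le_of_le_one_left (by positivity) hu2
    refine (Real.rpow_le_rpow (Finset.sum_nonneg fun i _ => integral_nonneg fun ω =>
      sq_nonneg _) h3 (by positivity)).trans (le_of_eq ?_)
    rw [← Real.rpow_mul hE0, div_mul_div_cancel₀ hκ0.ne', div_self two_ne_zero, Real.rpow_one]
  have h4 : ∑ i, ∫ ω, ‖inner ℝ (block i u) (ε i ω)‖ ^ κ ∂μ ≤ E := by
    have h5 : ∀ i, ∫ ω, ‖inner ℝ (block i u) (ε i ω)‖ ^ κ ∂μ ≤ ‖block i u‖ ^ 2 * E := by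
      intro i
      rw [← h.moment i, ← integral_const_mul]
      refine integral_mono (integrable_rpow_of_memLp (hXL i) hκ0.le le_rfl)
        ((integrable_rpow_of_memLp (h.memLp i) hκ0.le le_rfl).const_mul _) fun ω => ?_
      calc ‖inner ℝ (block i u) (ε i ω)‖ ^ κ ≤ (‖block i u‖ * ‖ε i ω‖) ^ κ :=
            Real.rpow_le_rpow (norm_nonneg _) (norm_inner_le_norm _ _) hκ0.le
        _ = ‖block i u‖ ^ κ * ‖ε i ω‖ ^ κ := Real.mul_rpow (norm_nonneg _) (norm_nonneg _)
        _ ≤ ‖block i u‖ ^ 2 * ‖ε i ω‖ ^ κ := by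
            gcongr
            rw [← Real.rpow_two]
            exact Real.rpow_le_rpow_of_exponent_ge' (norm_nonneg _) (hb1 i) zero_le_two hκ.le
    refine (Finset.sum_le_sum fun i _ => h5 i).trans ?_
    rw [← Finset.sum_mul]
    exact mul_le_of_le_one_left hE0 hu2
  have hL : MemLp (fun ω => inner ℝ u (stack fun i => ε i ω)) (ENNReal.ofReal κ) μ :=
    h.memLp_stack.const_inner u
  have hi := (integrable_rpow_of_memLp hL hκ0.le le_rfl).mul_const (V ^ (q - κ / 2))
  have hm : Measurable fun ω => (max (inner ℝ u (stack fun i => ε i ω) ^ 2 - V) 0) ^ q :=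
    ((((measurable_const.inner h.measurable_stack).pow_const 2).sub_const _).max
      measurable_const).pow_const q
  have hpt : ∀ ω, (max (inner ℝ u (stack fun i => ε i ω) ^ 2 - V) 0) ^ q
      ≤ ‖inner ℝ u (stack fun i => ε i ω)‖ ^ κ * V ^ (q - κ / 2) := fun ω => by
    have h1 := max_sub_rpow_le (sq_nonneg (inner ℝ u (stack fun i => ε i ω))) hV hq
      (by linarith : q ≤ κ / 2)
    rwa [← sq_abs, ← Real.rpow_two, ← Real.rpow_mul (abs_nonneg _), mul_div_cancel₀ _ two_ne_zero,
      Real.rpow_two, sq_abs] at h1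
  have hint := hi.mono' hm.aestronglyMeasurable (ae_of_all μ fun ω => by
    rw [Real.norm_of_nonneg (Real.rpow_nonneg (le_max_right _ _) _)]; exact hpt ω)
  refine ⟨hint, (integral_mono hint hi hpt).trans ?_⟩
  rw [integral_mul_const, ← mul_assoc]
  refine mul_le_mul_of_nonneg_right (hR.trans ?_) (by positivity)
  nlinarith [mul_le_mul_of_nonneg_left (add_le_add h2 h4) hK]

/-! ### Comparison of the selected model with a competitor -/

section Oracle

variable {n d : ℕ}

lemma norm_sq_residual (S : Submodule ℝ (Stacked n d)) (F e : Stacked n d) :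
    ‖(F + e) - proj S (F + e)‖ ^ 2
      = ‖F - proj S F‖ ^ 2 + 2 * inner ℝ (F - proj S F) e + ‖e‖ ^ 2 - ‖proj S e‖ ^ 2 := by
  have h1 : (F + e) - proj S (F + e) = (F - proj S F) + (e - proj S e) := by
    rw [map_add]; abel
  have h2 : inner ℝ (F - proj S F) (proj S e) = 0 := by
    rw [← inner_proj_left, map_sub, proj_proj, sub_self, inner_zero_left]
  have h3 := norm_sq_sub_proj_add S e e
  rw [sub_add_cancel] at h3
  rw [h1, norm_add_sq_real, inner_sub_right, h2]
  linarith

lemma norm_sq_loss (S : Submodule ℝ (Stacked n d)) (F e : Stacked n d) :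
    ‖F - proj S (F + e)‖ ^ 2 = ‖F - proj S F‖ ^ 2 + ‖proj S e‖ ^ 2 := by
  have := norm_sq_sub_proj_add S F (-e)
  rw [map_neg, norm_neg] at this
  rw [← this, map_add, sub_add_eq_sub_sub, sub_eq_add_neg (F - proj S F)]

lemma norm_sq_loss_le (S : Submodule ℝ (Stacked n d)) (F e : Stacked n d) :
    ‖F - proj S (F + e)‖ ^ 2 ≤ ‖F‖ ^ 2 + ‖e‖ ^ 2 := by
  rw [norm_sq_loss]
  exact add_le_add (norm_sq_sub_proj_le S F)
    (pow_le_pow_left₀ (norm_nonneg _) (norm_proj_le S e) 2)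

/-- The direction of the bias `F - P F` of a model (`0` if the bias vanishes). -/
noncomputable def biasDir (S : Submodule ℝ (Stacked n d)) (F : Stacked n d) : Stacked n d :=
  ‖F - proj S F‖⁻¹ • (F - proj S F)

lemma norm_biasDir_le (S : Submodule ℝ (Stacked n d)) (F : Stacked n d) : ‖biasDir S F‖ ≤ 1 := by
  rw [biasDir, norm_smul, norm_inv, norm_norm]
  exact inv_mul_le_one

lemma inner_bias (S : Submodule ℝ (Stacked n d)) (F e : Stacked n d) :
    inner ℝ (F - proj S F) e = ‖F - proj S F‖ * inner ℝ (biasDir S F) e := by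
  rw [biasDir, real_inner_smul_left, ← mul_assoc]
  rcases eq_or_ne (F - proj S F) 0 with h | h
  · simp [h]
  · rw [mul_inv_cancel₀ (norm_ne_zero_iff.2 h), one_mul]

/-- Excess of the squared noise in the direction of the bias over a fraction of the penalty. -/
noncomputable def biasExcess (b V : ℝ) (S : Submodule ℝ (Stacked n d)) (F e : Stacked n d) : ℝ :=
  max (inner ℝ (biasDir S F) e ^ 2 - b / 8 * V) 0

/-- Excess of the squared projected noise over its mean `V`, up to the factor `1 + b / 2`. -/
noncomputable def projExcess (b V : ℝ) (S : Submodule ℝ (Stacked n d)) (e : Stacked n d) : ℝ :=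
  max (‖proj S e‖ ^ 2 - (1 + b / 2) * V) 0

/-- The deterministic comparison of the selected model `S'` with a competitor `S`, when the
penalty of `S'` overshoots the mean `V'` of the noise projected on `S'` by the factor `1 + b`.
The surplus `b * V'` pays for the cross term and for a multiple of the loss. -/
lemma loss_le_of_penalty {b V V' pen pen' : ℝ} (hb : 0 < b) (S S' : Submodule ℝ (Stacked n d))
    (F e : Stacked n d) (hpen : (1 + b) * V' ≤ pen')
    (hcrit : ‖(F + e) - proj S' (F + e)‖ ^ 2 + pen' ≤ ‖(F + e) - proj S (F + e)‖ ^ 2 + pen) :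
    b / (4 + 2 * b) * ‖F - proj S' (F + e)‖ ^ 2 ≤ (2 * ‖F - proj S F‖ ^ 2 + b / 8 * V) + pen
      + biasExcess b V S F e + 2 * biasExcess b V' S' F e + 2 * projExcess b V' S' e := by
  rw [norm_sq_residual, norm_sq_residual, inner_bias, inner_bias] at hcrit
  rw [norm_sq_loss]
  set r := ‖F - proj S F‖
  set r' := ‖F - proj S' F‖
  set t := inner ℝ (biasDir S F) e
  set t' := inner ℝ (biasDir S' F) e
  set c₀ := b / (4 + 2 * b) with hc₀
  have hc : c₀ * (4 + 2 * b) = b := div_mul_cancel₀ _ (by positivity)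
  have hc0 : 0 ≤ c₀ := by positivity
  have hc1 : c₀ ≤ 1 / 2 := by
    rw [hc₀, div_le_div_iff₀ (by positivity) two_pos]; linarith
  have h1 : t ^ 2 - b / 8 * V ≤ biasExcess b V S F e := le_max_left _ _
  have h2 : t' ^ 2 - b / 8 * V' ≤ biasExcess b V' S' F e := le_max_left _ _
  have h3 : ‖proj S' e‖ ^ 2 - (1 + b / 2) * V' ≤ projExcess b V' S' e := le_max_left _ _
  have h3' : 0 ≤ projExcess b V' S' e := le_max_right _ _
  have h4 : (1 + c₀) * (‖proj S' e‖ ^ 2 - (1 + b / 2) * V') ≤ 2 * projExcess b V' S' e := by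
    nlinarith
  have h5 : (1 + c₀) * (‖proj S' e‖ ^ 2 - (1 + b / 2) * V')
      = ‖proj S' e‖ ^ 2 + c₀ * ‖proj S' e‖ ^ 2 - (1 + 3 * b / 4) * V' := by
    linear_combination (-V' / 4) * hc
  have h6 : c₀ * r' ^ 2 ≤ 1 / 2 * r' ^ 2 := by gcongr
  nlinarith [sq_nonneg (r - t), sq_nonneg (r' + 2 * t'), sq_nonneg ‖proj S e‖]

end Oracle

/-- Hölder's inequality on a set of small probability. -/
lemma integral_indicator_rpow_le {Ω : Type*} [MeasurableSpace Ω] {μ : Measure Ω}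
    [IsProbabilityMeasure μ] {H : Type*} [NormedAddCommGroup H] {X : Ω → H} {κ r : ℝ}
    (hr : 0 < r) (hrκ : r < κ) (hX : MemLp X (ENNReal.ofReal κ) μ) {B : Set Ω}
    (hB : MeasurableSet B) :
    ∫ ω, B.indicator 1 ω * ‖X ω‖ ^ r ∂μ
      ≤ μ.real B ^ (1 - r / κ) * (∫ ω, ‖X ω‖ ^ κ ∂μ) ^ (r / κ) := by
  have hκ0 : 0 < κ := hr.trans hrκ
  have hrk : 0 < 1 - r / κ := by rw [sub_pos, div_lt_one hκ0]; exact hrκ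
  have hconj : (1 / (1 - r / κ)).HolderConjugate (κ / r) := by
    rw [Real.holderConjugate_iff]
    refine ⟨(one_lt_div hrk).2 (by linarith [div_pos hr hκ0]), ?_⟩
    rw [one_div, inv_inv, inv_div]; ring
  have eX : ∀ ω, (‖X ω‖ ^ r) ^ (κ / r) = ‖X ω‖ ^ κ := fun ω => by
    rw [← Real.rpow_mul (norm_nonneg _), mul_div_cancel₀ _ hr.ne']
  have m1 : MemLp (B.indicator (1 : Ω → ℝ)) (ENNReal.ofReal (1 / (1 - r / κ))) μ :=
    (memLp_const (1 : ℝ)).indicator hB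
  have m2 : MemLp (fun ω => ‖X ω‖ ^ r) (ENNReal.ofReal (κ / r)) μ := by
    refine memLp_ofReal_of_integrable
      (hX.1.norm.aemeasurable.pow_const _).aestronglyMeasurable (by positivity) ?_
    have : ∀ ω, ‖‖X ω‖ ^ r‖ = ‖X ω‖ ^ r := fun ω => Real.norm_of_nonneg (by positivity)
    simpa only [this, eX] using integrable_rpow_of_memLp hX hκ0.le le_rfl
  have h0 : ∀ ω, 0 ≤ B.indicator (1 : Ω → ℝ) ω := fun ω =>
    Set.indicator_nonneg (fun _ _ => zero_le_one) ω
  have h := integral_mul_le_Lp_mul_Lq_of_nonneg hconj (ae_of_all μ h0)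
    (ae_of_all μ fun ω => by positivity) m1 m2
  have eB : ∀ ω, B.indicator (1 : Ω → ℝ) ω ^ (1 / (1 - r / κ)) = B.indicator 1 ω := fun ω => by
    by_cases hω : ω ∈ B
    · simp [hω]
    · simp only [Set.indicator_of_notMem hω]
      rw [Real.zero_rpow (by positivity)]
  simp only [eB, eX, one_div_div, integral_indicator_one hB, div_one] at h
  exact h

/-- The variance factor of a model, rewritten in terms of the weights of `DeltaKappa`. -/
lemma modelDim_mul_rpow_le {n d : ℕ} {M : Type*} [Fintype M] [Nonempty M] {q κ : ℝ} (hq : 0 < q)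
    (Φ : Matrix (Fin d) (Fin d) ℝ) (S : M → Submodule ℝ (Stacked n d)) (m : M)
    (hD : 0 < modelDim (S m)) (hδ : 0 < deltaSq Φ (S m)) :
    (modelDim (S m) : ℝ) * (deltaSq Φ (S m) * modelDim (S m)) ^ (q - κ / 2)
      ≤ deltaSupSq Φ S ^ q *
        (delta Φ (S m) ^ (-κ) * (modelDim (S m) : ℝ) ^ (-(κ / 2 - 1 - q))) := by
  have hD' : (0 : ℝ) < modelDim (S m) := by exact_mod_cast hD
  have hsup : deltaSq Φ (S m) ≤ deltaSupSq Φ S :=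
    Finset.le_sup' (fun m => deltaSq Φ (S m)) (Finset.mem_univ m)
  have e1 : delta Φ (S m) ^ (-κ) = deltaSq Φ (S m) ^ (-(κ / 2)) := by
    rw [delta, Real.sqrt_eq_rpow, ← Real.rpow_mul hδ.le]; congr 1; ring
  have e2 : (modelDim (S m) : ℝ) * (deltaSq Φ (S m) * modelDim (S m)) ^ (q - κ / 2)
      = deltaSq Φ (S m) ^ q * (deltaSq Φ (S m) ^ (-(κ / 2)) *
        (modelDim (S m) : ℝ) ^ (-(κ / 2 - 1 - q))) := by
    rw [Real.mul_rpow hδ.le hD'.le, ← mul_assoc (deltaSq Φ (S m) ^ q), ← Real.rpow_add hδ,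
      show -(κ / 2 - 1 - q) = (q - κ / 2) + 1 by ring, Real.rpow_add_one hD'.ne',
      ← sub_eq_add_neg]
    ring
  rw [e2, e1]
  gcongr

/-! ### Integrated loss bound -/

lemma rpow_le_of_le_five {x a b c d e q : ℝ} (hx : 0 ≤ x) (ha : 0 ≤ a) (hb : 0 ≤ b) (hc : 0 ≤ c)
    (hd : 0 ≤ d) (he : 0 ≤ e) (h : x ≤ a + b + c + 2 * d + 2 * e) (hq : 0 < q) (hq1 : q ≤ 1) :
    x ^ q ≤ a ^ q + b ^ q + c ^ q + 2 * d ^ q + 2 * e ^ q := by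
  have h2 : ∀ y : ℝ, 0 ≤ y → (2 * y) ^ q ≤ 2 * y ^ q := fun y hy => by
    have := Real.rpow_add_le_add_rpow hy hy hq.le hq1
    rwa [← two_mul, ← two_mul] at this
  have h3 := Real.rpow_le_rpow hx h hq.le
  have h4 := Real.rpow_add_le_add_rpow (by positivity : 0 ≤ a + b + c + 2 * d)
    (by positivity : 0 ≤ 2 * e) hq.le hq1
  have h5 := Real.rpow_add_le_add_rpow (by positivity : 0 ≤ a + b + c)
    (by positivity : 0 ≤ 2 * d) hq.le hq1
  have h6 := Real.rpow_add_le_add_rpow (by positivity : 0 ≤ a + b) hc hq.le hq1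
  have h7 := Real.rpow_add_le_add_rpow ha hb hq.le hq1
  linarith [h2 d hd, h2 e he]

lemma rpow_add_four_le {a b c d s : ℝ} (ha : 0 ≤ a) (hb : 0 ≤ b) (hc : 0 ≤ c) (hd : 0 ≤ d)
    (hs : 1 ≤ s) :
    (a + b + c + d) ^ s ≤ 4 ^ (s - 1) * (a ^ s + b ^ s + c ^ s + d ^ s) := by
  have := Real.rpow_sum_le_const_mul_sum_rpow_of_nonneg (s := (Finset.univ : Finset (Fin 4)))
    (f := ![a, b, c, d]) hs (fun i _ => by fin_cases i <;> simpa)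
  simpa [Fin.sum_univ_four] using this

section EmpNorm

variable {n d : ℕ}

lemma empNorm_sq (v : Stacked n d) : empNorm v ^ 2 = ‖v‖ ^ 2 / n := by
  rw [empNorm, Real.sq_sqrt (mul_nonneg (by positivity) (Finset.sum_nonneg fun i _ =>
    Finset.sum_nonneg fun a _ => mul_self_nonneg _)), EuclideanSpace.norm_sq_eq,
    Fintype.sum_prod_type]
  simp only [Real.norm_eq_abs, sq_abs, ← sq]
  ring

lemma empNorm_nonneg (v : Stacked n d) : 0 ≤ empNorm v := Real.sqrt_nonneg _

lemma empNorm_rpow (v : Stacked n d) (q : ℝ) :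
    empNorm v ^ (2 * q) = (‖v‖ ^ 2) ^ q / (n : ℝ) ^ q := by
  rw [Real.rpow_mul (empNorm_nonneg v), Real.rpow_two, empNorm_sq,
    Real.div_rpow (sq_nonneg _) (Nat.cast_nonneg n)]

end EmpNorm

lemma sum_weight_nonneg {n d : ℕ} {M : Type*} [Fintype M] (κ q : ℝ)
    (Φ : Matrix (Fin d) (Fin d) ℝ) (S : M → Submodule ℝ (Stacked n d)) :
    0 ≤ ∑ m, delta Φ (S m) ^ (-κ) * (modelDim (S m) : ℝ) ^ (-(κ / 2 - 1 - q)) :=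
  Finset.sum_nonneg fun _ _ => mul_nonneg (Real.rpow_nonneg (Real.sqrt_nonneg _) _)
    (Real.rpow_nonneg (Nat.cast_nonneg _) _)

/-- Majorant of the `q`-th power of the (rescaled) squared loss on the event where no penalty is
underestimated: oracle terms of a competitor `m`, and excess terms summed over all models. -/
noncomputable def lossBound {Ω : Type*} {n d : ℕ} {M : Type*} [Fintype M] (b θ q : ℝ)
    (Φ : Matrix (Fin d) (Fin d) ℝ) (S : M → Submodule ℝ (Stacked n d)) (F : Stacked n d)
    (e : Ω → Stacked n d) (s : Ω → ℝ) (m : M) (ω : Ω) : ℝ :=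
  (2 * ‖F - proj (S m) F‖ ^ 2 + b / 8 * (deltaSq Φ (S m) * modelDim (S m))) ^ q
    + ((1 + θ) * modelDim (S m) * s ω) ^ q
    + 3 * ∑ m', biasExcess b (deltaSq Φ (S m') * modelDim (S m')) (S m') F (e ω) ^ q
    + 2 * ∑ m', projExcess b (deltaSq Φ (S m') * modelDim (S m')) (S m') (e ω) ^ q

lemma lossBound_nonneg {Ω : Type*} {n d : ℕ} {M : Type*} [Fintype M] {b θ q : ℝ} (hb : 0 < b)
    (hθ : 0 < θ) {Φ : Matrix (Fin d) (Fin d) ℝ} {S : M → Submodule ℝ (Stacked n d)}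
    {F : Stacked n d} {e : Ω → Stacked n d} {s : Ω → ℝ} {m : M} {ω : Ω}
    (hδ : 0 ≤ deltaSq Φ (S m)) (hs : 0 ≤ s ω) :
    0 ≤ lossBound b θ q Φ S F e s m ω := by
  have h1 : 0 ≤ ∑ m', biasExcess b (deltaSq Φ (S m') * modelDim (S m')) (S m') F (e ω) ^ q :=
    Finset.sum_nonneg fun _ _ => Real.rpow_nonneg (le_max_right _ _) _
  have h2 : 0 ≤ ∑ m', projExcess b (deltaSq Φ (S m') * modelDim (S m')) (S m') (e ω) ^ q :=
    Finset.sum_nonneg fun _ _ => Real.rpow_nonneg (le_max_right _ _) _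
  unfold lossBound
  positivity

/-- The expectation of `lossBound`: the oracle term comes from Jensen's inequality for the estimated
penalty, the weighted sum over the models from the two deviation bounds. -/
theorem exists_integral_lossBound_le {κ q b θ : ℝ} (hκ : 2 < κ) (hq : 0 < q) (hq1 : q ≤ 1)
    (hb : 0 < b) (hθ : 0 < θ) :
    ∃ K : ℝ, 0 ≤ K ∧ ∀ {Ω : Type*} [MeasurableSpace Ω] {μ : Measure Ω} [IsProbabilityMeasure μ]
      {M : Type*} [Fintype M] [Nonempty M] {n d : ℕ}
      {ε : Fin n → Ω → EuclideanSpace ℝ (Fin d)} {E : ℝ} {Φ : Matrix (Fin d) (Fin d) ℝ}, 0 < n →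
      IsNoise μ ε κ E Φ → ∀ (F : Stacked n d) (S : M → Submodule ℝ (Stacked n d)),
      (∀ m, 0 < modelDim (S m)) → (∀ m, 0 < deltaSq Φ (S m)) →
      ∀ (s : Ω → ℝ) (m : M), (∀ ω, 0 ≤ s ω) → Integrable s μ → ∫ ω, s ω ∂μ ≤ deltaSq Φ (S m) →
      Integrable (lossBound b θ q Φ S F (fun ω => stack fun i => ε i ω) s m) μ ∧
      ∫ ω, lossBound b θ q Φ S F (fun ω => stack fun i => ε i ω) s m ω ∂μ
        ≤ K * (‖F - proj (S m) F‖ ^ 2 + deltaSq Φ (S m) * modelDim (S m)) ^ q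
          + K * (deltaSupSq Φ S ^ q * (E * ∑ m, delta Φ (S m) ^ (-κ) *
            (modelDim (S m) : ℝ) ^ (-(κ / 2 - 1 - q)))) := by
  obtain ⟨K₁, hK₁, hbias⟩ := exists_integral_inner_sq_sub_le hκ hq hq1
  obtain ⟨K₂, hK₂, hproj⟩ := exists_integral_norm_sq_proj_sub_le (η := b / 2) hκ hq hq1
    (by positivity)
  refine ⟨((2 + b / 8) ^ q + (1 + θ) ^ q) + (3 * (K₁ * (b / 8) ^ (q - κ / 2)) + 2 * K₂),
    by positivity, fun {Ω _ μ _ M _ _ n d ε E Φ} hn h F S hD hδ s m hs0 hsi hs => ?_⟩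
  set e : Ω → Stacked n d := fun ω => stack fun i => ε i ω with he
  set V : M → ℝ := fun m => deltaSq Φ (S m) * modelDim (S m) with hVdef
  have hD' : ∀ m, (1 : ℝ) ≤ modelDim (S m) := fun m => by exact_mod_cast hD m
  have hV : ∀ m, 0 < V m := fun m => mul_pos (hδ m) (by linarith [hD' m])
  have hE : 0 ≤ E := h.moment_nonneg ⟨0, hn⟩
  have h1 : ∀ m, Integrable (fun ω => biasExcess b (V m) (S m) F (e ω) ^ q) μ ∧
      ∫ ω, biasExcess b (V m) (S m) F (e ω) ^ q ∂μ
        ≤ K₁ * (b / 8) ^ (q - κ / 2) * (E * (modelDim (S m) * V m ^ (q - κ / 2))) := fun m => by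
    obtain ⟨hi, hle⟩ := hbias hn h (biasDir (S m) F) (norm_biasDir_le _ _)
      (V := b / 8 * V m) (mul_pos (by positivity) (hV m))
    refine ⟨hi, hle.trans ?_⟩
    rw [Real.mul_rpow (by positivity) (hV m).le]
    have hp : 0 ≤ V m ^ (q - κ / 2) := Real.rpow_nonneg (hV m).le _
    calc _ = K₁ * (b / 8) ^ (q - κ / 2) * (E * (1 * V m ^ (q - κ / 2))) := by ring
      _ ≤ _ := by gcongr; exact hD' m
  have h2 : ∀ m, Integrable (fun ω => projExcess b (V m) (S m) (e ω) ^ q) μ ∧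
      ∫ ω, projExcess b (V m) (S m) (e ω) ^ q ∂μ
        ≤ K₂ * (E * (modelDim (S m) * V m ^ (q - κ / 2))) := fun m => by
    obtain ⟨hi, hle⟩ := hproj hn h (S m) (hD m) (hδ m)
    exact ⟨hi, hle.trans (le_of_eq (by ring))⟩
  have h3 : ∑ m, E * (modelDim (S m) * V m ^ (q - κ / 2)) ≤ deltaSupSq Φ S ^ q *
      (E * ∑ m, delta Φ (S m) ^ (-κ) * (modelDim (S m) : ℝ) ^ (-(κ / 2 - 1 - q))) := by
    rw [← Finset.mul_sum, mul_left_comm]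
    refine mul_le_mul_of_nonneg_left ?_ hE
    rw [Finset.mul_sum]
    exact Finset.sum_le_sum fun m _ => modelDim_mul_rpow_le hq Φ S m (hD m) (hδ m)
  -- the estimated penalty, by Jensen's inequality
  have hs1 : MemLp s (ENNReal.ofReal 1) μ := by
    rw [ENNReal.ofReal_one]; exact memLp_one_iff_integrable.2 hsi
  have hsq : Integrable (fun ω => s ω ^ q) μ := by
    have := integrable_rpow_of_memLp hs1 hq.le hq1
    simpa only [Real.norm_of_nonneg (hs0 _)] using this
  have hpen : ∀ ω, ((1 + θ) * modelDim (S m) * s ω) ^ q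
      = ((1 + θ) * modelDim (S m)) ^ q * s ω ^ q := fun ω =>
    Real.mul_rpow (by positivity) (hs0 ω)
  have hpi : Integrable (fun ω => ((1 + θ) * modelDim (S m) * s ω) ^ q) μ := by
    simp only [hpen]; exact hsq.const_mul _
  have hple : ∫ ω, ((1 + θ) * modelDim (S m) * s ω) ^ q ∂μ ≤ (1 + θ) ^ q * V m ^ q := by
    have hj := integral_rpow_le_rpow (μ := μ) hs0 hq hq1 hsq (by simpa only [Real.rpow_one] using hsi)
    simp only [Real.rpow_one, div_one] at hj
    have hj' := hj.trans (Real.rpow_le_rpow (integral_nonneg hs0) hs hq.le)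
    simp only [hpen]
    rw [integral_const_mul]
    calc _ ≤ ((1 + θ) * modelDim (S m)) ^ q * deltaSq Φ (S m) ^ q := by gcongr
      _ = _ := by
        rw [← Real.mul_rpow (by positivity) (hδ m).le, ← Real.mul_rpow (by positivity) (hV m).le]
        congr 1
        simp only [hVdef]; ring
  have i1 : Integrable (fun ω => ∑ m', biasExcess b (V m') (S m') F (e ω) ^ q) μ :=
    integrable_finsetSum _ fun m' _ => (h1 m').1
  have i2 : Integrable (fun ω => ∑ m', projExcess b (V m') (S m') (e ω) ^ q) μ :=
    integrable_finsetSum _ fun m' _ => (h2 m').1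
  have i0 : Integrable (fun _ : Ω => (2 * ‖F - proj (S m) F‖ ^ 2 + b / 8 * V m) ^ q) μ :=
    integrable_const _
  refine ⟨((i0.add hpi).add (i1.const_mul 3)).add (i2.const_mul 2), ?_⟩
  have hint : ∫ ω, lossBound b θ q Φ S F e s m ω ∂μ
      = (2 * ‖F - proj (S m) F‖ ^ 2 + b / 8 * V m) ^ q
        + ∫ ω, ((1 + θ) * modelDim (S m) * s ω) ^ q ∂μ
        + 3 * ∑ m', ∫ ω, biasExcess b (V m') (S m') F (e ω) ^ q ∂μ
        + 2 * ∑ m', ∫ ω, projExcess b (V m') (S m') (e ω) ^ q ∂μ := by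
    unfold lossBound
    rw [integral_add ((i0.fun_add hpi).fun_add (i1.const_mul 3)) (i2.const_mul 2),
      integral_add (i0.fun_add hpi) (i1.const_mul 3), integral_add i0 hpi, integral_const_mul,
      integral_const_mul, integral_finsetSum _ fun m' _ => (h1 m').1,
      integral_finsetSum _ fun m' _ => (h2 m').1]
    simp
  have hs1 : ∑ m', ∫ ω, biasExcess b (V m') (S m') F (e ω) ^ q ∂μ
      ≤ K₁ * (b / 8) ^ (q - κ / 2) * ∑ m, E * (modelDim (S m) * V m ^ (q - κ / 2)) := by
    rw [Finset.mul_sum]; exact Finset.sum_le_sum fun m' _ => (h1 m').2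
  have hs2 : ∑ m', ∫ ω, projExcess b (V m') (S m') (e ω) ^ q ∂μ
      ≤ K₂ * ∑ m, E * (modelDim (S m) * V m ^ (q - κ / 2)) := by
    rw [Finset.mul_sum]; exact Finset.sum_le_sum fun m' _ => (h2 m').2
  set T := ∑ m, E * (modelDim (S m) * V m ^ (q - κ / 2)) with hT
  set T' := deltaSupSq Φ S ^ q *
      (E * ∑ m, delta Φ (S m) ^ (-κ) * (modelDim (S m) : ℝ) ^ (-(κ / 2 - 1 - q))) with hT'
  have hT0 : 0 ≤ T := Finset.sum_nonneg fun m _ => mul_nonneg hE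
    (mul_nonneg (Nat.cast_nonneg _) (Real.rpow_nonneg (hV m).le _))
  set a := ‖F - proj (S m) F‖ ^ 2 + V m with ha
  have ha0 : 0 ≤ a := by have := hV m; positivity
  have hVa : V m ^ q ≤ a ^ q := Real.rpow_le_rpow (hV m).le (by rw [ha]; nlinarith) hq.le
  have h4 : (2 * ‖F - proj (S m) F‖ ^ 2 + b / 8 * V m) ^ q ≤ (2 + b / 8) ^ q * a ^ q := by
    rw [← Real.mul_rpow (by positivity) ha0]
    have hVm := (hV m).le
    refine Real.rpow_le_rpow (by positivity) ?_ hq.le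
    rw [ha]
    nlinarith [sq_nonneg ‖F - proj (S m) F‖, mul_nonneg hb.le (sq_nonneg ‖F - proj (S m) F‖)]
  rw [hint]
  have h5 : (1 + θ) ^ q * V m ^ q ≤ (1 + θ) ^ q * a ^ q := by gcongr
  have hc1 : 0 ≤ K₁ * (b / 8) ^ (q - κ / 2) := by positivity
  have haq : 0 ≤ a ^ q := by positivity
  have h6 := mul_le_mul_of_nonneg_left h3 (by positivity :
    0 ≤ 3 * (K₁ * (b / 8) ^ (q - κ / 2)) + 2 * K₂)
  have h7 : 0 ≤ ((2 + b / 8) ^ q + (1 + θ) ^ q) * T' :=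
    mul_nonneg (by positivity) (hT0.trans h3)
  have h8 : 0 ≤ (3 * (K₁ * (b / 8) ^ (q - κ / 2)) + 2 * K₂) * a ^ q := by positivity
  nlinarith

/-! ### The risk bound -/

/-- On the event where the penalty of the selected model `m'` is large enough, the loss is
controlled by `lossBound` for every competitor `m`. -/
lemma loss_rpow_le_lossBound {Ω : Type*} {n d : ℕ} {M : Type*} [Fintype M] {θ α q : ℝ}
    (hθ : 0 < θ) (hαθ : 1 < (1 + θ) * (1 - α)) (hq : 0 < q) (hq1 : q ≤ 1)
    {Φ : Matrix (Fin d) (Fin d) ℝ} {S : M → Submodule ℝ (Stacked n d)} {F : Stacked n d}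
    {e : Ω → Stacked n d} {s : M → Ω → ℝ} {m m' : M} {ω : Ω} (hn : 0 < n)
    (hδ : 0 ≤ deltaSq Φ (S m)) (hs : 0 ≤ s m ω) (hs' : (1 - α) * deltaSq Φ (S m') ≤ s m' ω)
    (hcrit : criterion θ (s m' ω) (S m') (F + e ω) ≤ criterion θ (s m ω) (S m) (F + e ω)) :
    (‖F - proj (S m') (F + e ω)‖ ^ 2) ^ q ≤
      ((((1 + θ) * (1 - α) - 1) / (4 + 2 * ((1 + θ) * (1 - α) - 1))) ^ q)⁻¹ *
        lossBound ((1 + θ) * (1 - α) - 1) θ q Φ S F e (s m) m ω := by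
  set b := (1 + θ) * (1 - α) - 1 with hb
  have hb0 : 0 < b := by rw [hb]; linarith
  have hn' : (0 : ℝ) < n := by exact_mod_cast hn
  have hcrit' : ‖(F + e ω) - proj (S m') (F + e ω)‖ ^ 2 + (1 + θ) * modelDim (S m') * s m' ω
      ≤ ‖(F + e ω) - proj (S m) (F + e ω)‖ ^ 2 + (1 + θ) * modelDim (S m) * s m ω := by
    simp only [criterion, penalty, empNorm_sq] at hcrit
    have h1 := mul_le_mul_of_nonneg_left hcrit hn'.le
    have h2 : ∀ x z : ℝ, ∀ D : ℕ, (n : ℝ) * (x / n + (1 + θ) * (z * D / n))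
        = x + (1 + θ) * D * z := fun x z D => by field_simp
    rwa [h2, h2] at h1
  have hpen : (1 + b) * (deltaSq Φ (S m') * modelDim (S m'))
      ≤ (1 + θ) * modelDim (S m') * s m' ω := by
    have : (1 + b) * (deltaSq Φ (S m') * modelDim (S m'))
        = (1 + θ) * modelDim (S m') * ((1 - α) * deltaSq Φ (S m')) := by rw [hb]; ring
    rw [this]
    gcongr
  have hmain := loss_le_of_penalty (V := deltaSq Φ (S m) * modelDim (S m)) hb0 (S m) (S m') F
    (e ω) hpen hcrit'
  have hz : ∀ V S, 0 ≤ biasExcess b V S F (e ω) := fun V S => le_max_right _ _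
  have hw : ∀ V S, 0 ≤ projExcess b V S (e ω) := fun V S => le_max_right _ _
  have h5 := rpow_le_of_le_five (by positivity) (by positivity) (by positivity) (hz _ _) (hz _ _)
    (hw _ _) hmain hq hq1
  rw [Real.mul_rpow (by positivity) (sq_nonneg _)] at h5
  have hsz : ∀ m'', biasExcess b (deltaSq Φ (S m'') * modelDim (S m'')) (S m'') F (e ω) ^ q
      ≤ ∑ m', biasExcess b (deltaSq Φ (S m') * modelDim (S m')) (S m') F (e ω) ^ q := fun m'' =>
    Finset.single_le_sum
      (f := fun m' => biasExcess b (deltaSq Φ (S m') * modelDim (S m')) (S m') F (e ω) ^ q)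
      (fun _ _ => Real.rpow_nonneg (hz _ _) _) (Finset.mem_univ m'')
  have hsw : ∀ m'', projExcess b (deltaSq Φ (S m'') * modelDim (S m'')) (S m'') (e ω) ^ q
      ≤ ∑ m', projExcess b (deltaSq Φ (S m') * modelDim (S m')) (S m') (e ω) ^ q := fun m'' =>
    Finset.single_le_sum
      (f := fun m' => projExcess b (deltaSq Φ (S m') * modelDim (S m')) (S m') (e ω) ^ q)
      (fun _ _ => Real.rpow_nonneg (hw _ _) _) (Finset.mem_univ m'')
  have hc : 0 < (b / (4 + 2 * b)) ^ q := by positivity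
  rw [inv_mul_eq_div, le_div_iff₀ hc, mul_comm]
  unfold lossBound
  linarith [hsz m, hsz m', hsw m']

/-- Contribution of the event where some variance estimator is too small. -/
lemma integral_indicator_loss_le {Ω : Type*} [MeasurableSpace Ω] {μ : Measure Ω}
    [IsProbabilityMeasure μ] {n d : ℕ} {ε : Fin n → Ω → EuclideanSpace ℝ (Fin d)} {κ E q Ct γ : ℝ}
    {Φ : Matrix (Fin d) (Fin d) ℝ} (hn : 0 < n) (hq : 0 < q) (hκ : 2 ≤ κ) (hqκ : 2 * q < κ)
    (h : IsNoise μ ε κ E Φ) (hγ : q / (1 - 2 * q / κ) ≤ γ) {B : Set Ω} (hB : MeasurableSet B)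
    (hBμ : μ.real B ≤ Ct * (1 / (n : ℝ) ^ γ)) (F : Stacked n d) :
    ∫ ω, B.indicator 1 ω * ((‖F‖ ^ 2) ^ q + ‖stack fun i => ε i ω‖ ^ (2 * q)) ∂μ
      ≤ Ct ^ (1 - 2 * q / κ) * (empNorm F ^ 2) ^ q
        + Ct ^ (1 - 2 * q / κ) * (E ^ (2 / κ)) ^ q := by
  have hn' : (0 : ℝ) < n := by exact_mod_cast hn
  have hn1 : (1 : ℝ) ≤ n := by exact_mod_cast hn
  have hκ0 : 0 < κ := by linarith
  have hE : 0 ≤ E := h.moment_nonneg ⟨0, hn⟩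
  set τ := 1 - 2 * q / κ with hτ
  have hτ0 : 0 < τ := by rw [hτ, sub_pos, div_lt_one hκ0]; exact hqκ
  have hτ1 : τ ≤ 1 := by rw [hτ]; linarith [div_pos (by positivity : 0 < 2 * q) hκ0]
  have hCt : 0 ≤ Ct := by
    have h1 : 0 ≤ Ct * (1 / (n : ℝ) ^ γ) := measureReal_nonneg.trans hBμ
    exact nonneg_of_mul_nonneg_left h1 (by positivity)
  have hp : μ.real B ^ τ ≤ Ct ^ τ / (n : ℝ) ^ q := by
    calc μ.real B ^ τ ≤ (Ct * (1 / (n : ℝ) ^ γ)) ^ τ :=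
          Real.rpow_le_rpow measureReal_nonneg hBμ hτ0.le
      _ = Ct ^ τ / (n : ℝ) ^ (γ * τ) := by
          rw [mul_one_div, Real.div_rpow hCt (by positivity), ← Real.rpow_mul hn'.le]
      _ ≤ _ := by
          gcongr
          exact (div_le_iff₀ hτ0).1 hγ
  have hp1 : μ.real B ≤ μ.real B ^ τ := by
    have := Real.rpow_le_rpow_of_exponent_ge' (measureReal_nonneg (μ := μ) (s := B))
      measureReal_le_one hτ0.le hτ1
    rwa [Real.rpow_one] at this
  have hX := h.memLp_stack
  have hH := integral_indicator_rpow_le (r := 2 * q) (by positivity) hqκ hX hB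
  have i1 : Integrable (fun ω => B.indicator (1 : Ω → ℝ) ω * (‖F‖ ^ 2) ^ q) μ :=
    ((integrable_const (1 : ℝ)).indicator hB).mul_const _
  have i2 : Integrable (fun ω => B.indicator (1 : Ω → ℝ) ω * ‖stack fun i => ε i ω‖ ^ (2 * q)) μ := by
    have := (integrable_rpow_of_memLp hX (by positivity : 0 ≤ 2 * q) hqκ.le).indicator hB
    refine this.congr (ae_of_all μ fun ω => ?_)
    by_cases hω : ω ∈ B <;> simp [hω]
  simp only [mul_add]
  rw [integral_add i1 i2, integral_mul_const, integral_indicator_one hB]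
  refine add_le_add ?_ (hH.trans ?_)
  · rw [empNorm_sq, Real.div_rpow (sq_nonneg _) hn'.le]
    calc _ ≤ Ct ^ τ / (n : ℝ) ^ q * (‖F‖ ^ 2) ^ q := by gcongr; exact hp1.trans hp
      _ = _ := by ring
  · have h1 : (∫ ω, ‖stack fun i => ε i ω‖ ^ κ ∂μ) ^ (2 * q / κ)
        ≤ (n : ℝ) ^ q * (E ^ (2 / κ)) ^ q := by
      refine (Real.rpow_le_rpow (integral_nonneg fun ω => by positivity)
        (h.integral_norm_stack_rpow_le hκ hn) (by positivity)).trans (le_of_eq ?_)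
      rw [Real.mul_rpow (by positivity) hE, ← Real.rpow_mul hn'.le, ← Real.rpow_mul hE]
      congr 2 <;> field_simp
    calc _ ≤ Ct ^ τ / (n : ℝ) ^ q * ((n : ℝ) ^ q * (E ^ (2 / κ)) ^ q) := by gcongr
      _ = _ := by field_simp

lemma measurable_comp_selection {Ω : Type*} [MeasurableSpace Ω] {M : Type*} [Fintype M]
    {msel : Ω → M} (hmsel : ∀ m, MeasurableSet {ω | msel ω = m}) {g : M → Ω → ℝ}
    (hg : ∀ m, Measurable (g m)) : Measurable fun ω => g (msel ω) ω := by
  classical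
  have e : (fun ω => g (msel ω) ω) = fun ω => ∑ m, {ω | msel ω = m}.indicator (g m) ω := by
    ext ω
    rw [Finset.sum_eq_single (msel ω) (fun m _ hm => ?_) (by simp)]
    · simp
    · exact Set.indicator_of_notMem (fun h => hm h.symm) _
  rw [e]
  exact Finset.measurable_fun_sum _ fun m _ => (hg m).indicator (hmsel m)

/-- Taking `1 / q`-th powers in the integrated bound. -/
lemma div_rpow_one_div_le {q I K a P Q e2 f2 : ℝ} {n : ℕ} (hq : 0 < q) (hq1 : q ≤ 1)
    (hn : 0 < n) (hI : 0 ≤ I) (hK : 0 ≤ K) (ha : 0 ≤ a) {σ : ℝ} (hσ : 0 ≤ σ) (hP : 0 ≤ P)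
    (hQ : 0 ≤ Q) (he2 : 0 ≤ e2) (hf2 : 0 ≤ f2)
    (h : I ≤ K * a ^ q + K * (σ ^ q * P) + (Q * f2 ^ q + Q * e2 ^ q)) :
    (I / (n : ℝ) ^ q) ^ (1 / q) ≤ 4 ^ (1 / q - 1) * (K ^ (1 / q) + 1) * (a / n)
      + 4 ^ (1 / q - 1) * (K ^ (1 / q) + 1) / n *
        (Q ^ (1 / q) * (e2 + f2) + σ * P ^ (1 / q)) := by
  have hn' : (0 : ℝ) < n := by exact_mod_cast hn
  have hinv : ∀ x : ℝ, 0 ≤ x → (x ^ q) ^ (1 / q) = x := fun x hx => by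
    rw [← Real.rpow_mul hx, mul_one_div_cancel hq.ne', Real.rpow_one]
  have h1 : I ^ (1 / q) ≤ 4 ^ (1 / q - 1) * (K ^ (1 / q) * a + K ^ (1 / q) * (σ * P ^ (1 / q))
      + Q ^ (1 / q) * f2 + Q ^ (1 / q) * e2) := by
    rw [← add_assoc] at h
    refine (Real.rpow_le_rpow hI h (by positivity)).trans ?_
    refine (rpow_add_four_le (by positivity) (by positivity) (by positivity) (by positivity)
      ((one_le_div hq).2 hq1)).trans (le_of_eq ?_)
    rw [Real.mul_rpow hK (by positivity), Real.mul_rpow hK (by positivity),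
      Real.mul_rpow hQ (by positivity), Real.mul_rpow hQ (by positivity),
      Real.mul_rpow (by positivity) hP, hinv a ha, hinv σ hσ, hinv f2 hf2, hinv e2 he2]
  rw [Real.div_rpow hI (by positivity), hinv _ hn'.le, div_le_iff₀ hn']
  have h2 : (4 ^ (1 / q - 1) * (K ^ (1 / q) + 1) * (a / n)
      + 4 ^ (1 / q - 1) * (K ^ (1 / q) + 1) / n *
        (Q ^ (1 / q) * (e2 + f2) + σ * P ^ (1 / q))) * n
      = 4 ^ (1 / q - 1) * ((K ^ (1 / q) + 1) * a + (K ^ (1 / q) + 1) *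
        (Q ^ (1 / q) * (e2 + f2) + σ * P ^ (1 / q))) := by
    field_simp
  rw [h2]
  refine h1.trans (mul_le_mul_of_nonneg_left ?_ (by positivity))
  have h3 : 0 ≤ σ * P ^ (1 / q) := by positivity
  have h4 : 0 ≤ K ^ (1 / q) * (Q ^ (1 / q) * (e2 + f2)) := by positivity
  nlinarith

end VecReg

theorem mainTheorem2 (θ α q κ : ℝ) (hθ : 0 < θ) (hα : α ∈ Set.Ioo (0 : ℝ) 1)
    (hαθ : 1 < (1 + θ) * (1 - α)) (hq : 0 < q) (hq1 : q ≤ 1) (hκ : 2 * (1 + 2 * q) < κ) :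
    ∃ C > (0 : ℝ), ∃ c > (0 : ℝ),
      ∀ {Ω : Type*} [MeasurableSpace Ω] (μ : Measure Ω) [IsProbabilityMeasure μ]
        {M : Type*} [Fintype M] [Nonempty M] (n d : ℕ) (hn : 0 < n)
        -- the model: deterministic means, centred i.i.d. errors with a moment of order `κ`
        (f : Fin n → EuclideanSpace ℝ (Fin d))
        (ε : Fin n → Ω → EuclideanSpace ℝ (Fin d)),
        (∀ i, Measurable (ε i)) →
        iIndepFun ε μ →
        (∀ i, IdentDistrib (ε i) (ε ⟨0, hn⟩) μ μ) →
        Integrable (fun ω => ‖ε ⟨0, hn⟩ ω‖ ^ κ) μ →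
        ∫ ω, ε ⟨0, hn⟩ ω ∂μ = 0 →
        ∀ (y : Ω → VecReg.Stacked n d),
        (∀ ω, y ω = VecReg.stack fun i => f i + ε i ω) →
        ∀ (Φ : Matrix (Fin d) (Fin d) ℝ), Φ = VecReg.covMatrix μ (ε ⟨0, hn⟩) →
        -- the collection of models
        ∀ (S : M → Submodule ℝ (VecReg.Stacked n d)),
        (∀ m, 0 < VecReg.modelDim (S m)) →
        (∀ m, 0 < VecReg.deltaSq Φ (S m)) →
        -- the estimators of `δ_m²` with the assumptions A1 and A2
        ∀ (δhat : M → Ω → ℝ) (Ctilde γ : ℝ),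
        (∀ m, Integrable (fun ω => δhat m ω ^ 2) μ ∧
          ∫ ω, δhat m ω ^ 2 ∂μ ≤ VecReg.deltaSq Φ (S m)) →
        q / (1 - 2 * q / κ) ≤ γ →
        μ.real {ω | ∀ m, (1 - α) * VecReg.deltaSq Φ (S m) ≤ δhat m ω ^ 2}ᶜ
          ≤ Ctilde * (1 / (n : ℝ) ^ γ) →
        -- the selected model
        ∀ (msel : Ω → M),
        (∀ m, MeasurableSet {ω | msel ω = m}) →
        (∀ ω m, VecReg.criterion θ (δhat (msel ω) ω ^ 2) (S (msel ω)) (y ω)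
          ≤ VecReg.criterion θ (δhat m ω ^ 2) (S m) (y ω)) →
        Integrable (fun ω =>
          VecReg.empNorm (VecReg.stack f - VecReg.proj (S (msel ω)) (y ω)) ^ (2 * q)) μ ∧
        (∫ ω, VecReg.empNorm
            (VecReg.stack f - VecReg.proj (S (msel ω)) (y ω)) ^ (2 * q) ∂μ) ^ (1 / q)
          ≤ C * (⨅ m, (VecReg.empNorm (VecReg.stack f - VecReg.proj (S m) (VecReg.stack f)) ^ 2
                + VecReg.deltaSq Φ (S m) * (VecReg.modelDim (S m) : ℝ) / (n : ℝ)))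
            + C / (n : ℝ) *
              (VecReg.DeltaTilde q κ Ctilde *
                  ((∫ ω, ‖ε ⟨0, hn⟩ ω‖ ^ κ ∂μ) ^ (2 / κ) + VecReg.empNorm (VecReg.stack f) ^ 2)
                + VecReg.deltaSupSq Φ S *
                  VecReg.DeltaKappa c q κ (∫ ω, ‖ε ⟨0, hn⟩ ω‖ ^ κ ∂μ) Φ S) := by
  have hκ2 : 2 < κ := by linarith
  have hqκ : 2 * q < κ := by linarith
  -- the relative surplus of the penalty over the mean of the projected noise
  set b := (1 + θ) * (1 - α) - 1 with hb
  have hb0 : 0 < b := by rw [hb]; linarith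
  obtain ⟨K₀, hK₀, hbound⟩ := VecReg.exists_integral_lossBound_le hκ2 hq hq1 hb0 hθ
  set c₀ := ((b / (4 + 2 * b)) ^ q)⁻¹ with hc₀
  have hc₀0 : 0 ≤ c₀ := by positivity
  set K := c₀ * K₀ with hK
  have hK0 : 0 ≤ K := by positivity
  -- `4 ^ (1 / q - 1)` is the convexity constant for a sum of four terms raised to the power `1 / q`
  refine ⟨4 ^ (1 / q - 1) * (K ^ (1 / q) + 1), by positivity, 1, one_pos, ?_⟩
  intro Ω _ μ _ M _ _ n d hn f ε hm hind hid hint hmean y hy Φ hΦ S hD hδ δhat Ctilde γ hA1 hγ hA2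
    msel hmsel hsel
  have hnoise := VecReg.isNoise_of_identDistrib hκ2.le ⟨0, hn⟩ hm hind hid hint hmean
  rw [← hΦ] at hnoise
  set E := ∫ ω, ‖ε ⟨0, hn⟩ ω‖ ^ κ ∂μ with hE
  have hE0 : 0 ≤ E := hnoise.moment_nonneg ⟨0, hn⟩
  set F := VecReg.stack f with hF
  have hy' : ∀ ω, y ω = F + VecReg.stack fun i => ε i ω := fun ω => by
    rw [hy ω, VecReg.stack_add]
  simp only [hy'] at hsel ⊢
  set e : Ω → VecReg.Stacked n d := fun ω => VecReg.stack fun i => ε i ω with he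
  have hn' : (0 : ℝ) < n := by exact_mod_cast hn
  -- a measurable cover of the event where some estimator is too small, which need not be measurable
  set G : Set Ω := {ω | ∀ m, (1 - α) * VecReg.deltaSq Φ (S m) ≤ δhat m ω ^ 2} with hG
  set B := toMeasurable μ Gᶜ with hBdef
  have hB : MeasurableSet B := measurableSet_toMeasurable μ _
  have hBμ : μ.real B ≤ Ctilde * (1 / (n : ℝ) ^ γ) := by
    rw [Measure.real, hBdef, measure_toMeasurable]; exact hA2
  have hCt : 0 ≤ Ctilde :=
    nonneg_of_mul_nonneg_left (measureReal_nonneg.trans hBμ) (by positivity)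
  set loss : Ω → ℝ := fun ω => (‖F - VecReg.proj (S (msel ω)) (F + e ω)‖ ^ 2) ^ q with hloss
  have hloss0 : ∀ ω, 0 ≤ loss ω := fun ω => by positivity
  have hem : Measurable e := hnoise.measurable_stack
  have hlossm : Measurable loss := VecReg.measurable_comp_selection hmsel
    (g := fun m ω => (‖F - VecReg.proj (S m) (F + e ω)‖ ^ 2) ^ q) fun m =>
      ((measurable_const.sub ((VecReg.proj (S m)).measurable.comp
        (measurable_const.add hem))).norm.pow_const 2).pow_const q
  set rem : Ω → ℝ := fun ω => (‖F‖ ^ 2) ^ q + ‖e ω‖ ^ (2 * q) with hrem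
  have hremi : Integrable rem μ := (integrable_const _).add
    (integrable_rpow_of_memLp hnoise.memLp_stack (by positivity) hqκ.le)
  have hcrude : ∀ ω, loss ω ≤ rem ω := fun ω => by
    have h1 := Real.rpow_le_rpow (sq_nonneg _) (VecReg.norm_sq_loss_le (S (msel ω)) F (e ω)) hq.le
    have h2 := Real.rpow_add_le_add_rpow (sq_nonneg ‖F‖) (sq_nonneg ‖e ω‖) hq.le hq1
    have h3 : (‖e ω‖ ^ 2) ^ q = ‖e ω‖ ^ (2 * q) := by
      rw [← Real.rpow_two, ← Real.rpow_mul (norm_nonneg _)]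
    rw [h3] at h2
    exact h1.trans h2
  have hlossi : Integrable loss μ := hremi.mono' hlossm.aestronglyMeasurable
    (ae_of_all μ fun ω => by rw [Real.norm_of_nonneg (hloss0 ω)]; exact hcrude ω)
  simp only [VecReg.empNorm_rpow]
  refine ⟨hlossi.div_const _, ?_⟩
  rw [integral_div]
  -- the competitor is a model at which the infimum over the finite collection is attained
  obtain ⟨m, hmin⟩ := exists_eq_ciInf_of_finite (f := fun m =>
    VecReg.empNorm (F - VecReg.proj (S m) F) ^ 2
      + VecReg.deltaSq Φ (S m) * (VecReg.modelDim (S m) : ℝ) / (n : ℝ))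
  rw [← hmin]
  obtain ⟨hLi, hLle⟩ := hbound hn hnoise F S hD hδ (fun ω => δhat m ω ^ 2) m
    (fun ω => sq_nonneg _) (hA1 m).1 (hA1 m).2
  set T := E * ∑ m, VecReg.delta Φ (S m) ^ (-κ) *
    (VecReg.modelDim (S m) : ℝ) ^ (-(κ / 2 - 1 - q)) with hT
  have hT0 : 0 ≤ T := mul_nonneg hE0 (VecReg.sum_weight_nonneg κ q Φ S)
  have hpt : ∀ ω, loss ω ≤ c₀ * VecReg.lossBound b θ q Φ S F e (fun ω => δhat m ω ^ 2) m ω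
      + B.indicator 1 ω * rem ω := fun ω => by
    have hL0 := VecReg.lossBound_nonneg (q := q) (S := S) (F := F) (e := e) (m := m) (ω := ω)
      (s := fun ω => δhat m ω ^ 2) hb0 hθ (hδ m).le (sq_nonneg (δhat m ω))
    by_cases hω : ω ∈ B
    · rw [Set.indicator_of_mem hω, Pi.one_apply, one_mul]
      linarith [hcrude ω, mul_nonneg hc₀0 hL0]
    · have hωG : ω ∈ G := by
        by_contra hc
        exact hω (subset_toMeasurable μ _ hc)
      rw [Set.indicator_of_notMem hω, zero_mul, add_zero]
      exact VecReg.loss_rpow_le_lossBound (s := fun m ω => δhat m ω ^ 2) hθ hαθ hq hq1 hn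
        (hδ m).le (sq_nonneg _) (hωG (msel ω)) (hsel ω m)
  have hBi : Integrable (fun ω => B.indicator 1 ω * rem ω) μ := by
    refine (hremi.indicator hB).congr (ae_of_all μ fun ω => ?_)
    by_cases hω : ω ∈ B <;> simp [hω]
  have hoff := VecReg.integral_indicator_loss_le hn hq hκ2.le hqκ hnoise hγ hB hBμ F
  have hI : ∫ ω, loss ω ∂μ ≤
      K * (‖F - VecReg.proj (S m) F‖ ^ 2 + VecReg.deltaSq Φ (S m) * VecReg.modelDim (S m)) ^ q
        + K * (VecReg.deltaSupSq Φ S ^ q * T)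
        + (Ctilde ^ (1 - 2 * q / κ) * (VecReg.empNorm F ^ 2) ^ q
          + Ctilde ^ (1 - 2 * q / κ) * (E ^ (2 / κ)) ^ q) := by
    refine (integral_mono hlossi ((hLi.const_mul c₀).add hBi) hpt).trans ?_
    simp only [Pi.add_apply]
    rw [integral_add (hLi.const_mul c₀) hBi, integral_const_mul]
    refine add_le_add ((mul_le_mul_of_nonneg_left hLle hc₀0).trans (le_of_eq ?_)) hoff
    rw [hK]; ring
  have hsup0 : 0 ≤ VecReg.deltaSupSq Φ S := (hδ m).le.trans
    (Finset.le_sup' (fun m => VecReg.deltaSq Φ (S m)) (Finset.mem_univ m))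
  have hfin := VecReg.div_rpow_one_div_le hq hq1 hn (integral_nonneg hloss0) hK0
    (add_nonneg (sq_nonneg _) (mul_nonneg (hδ m).le (Nat.cast_nonneg _))) hsup0 hT0
    (Real.rpow_nonneg hCt _) (Real.rpow_nonneg hE0 _) (sq_nonneg _) hI
  rw [VecReg.empNorm_sq (F - _), ← add_div]
  simpa only [VecReg.DeltaTilde, VecReg.DeltaKappa, one_mul] using hfin
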